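/- Let $\ell\ge 1$ and let $Q^\star_\ell$ be the star query $$Q^\star_\ell(x_1,\dots,x_\ell)\leftarrow R_1(x_1,y)\wedge\dots\wedge R_\ell(x_\ell,y).$$ A database $D$ for it consists of finite relations $R_1,\dots,R_\ell\subseteq\mathbb N\times\mathbb N$; its size is $|D|=\sum_i|R_i|$, and its result is $$\mathrm{OUT}=Q^\star_\ell(D)=\{(x_1,\dots,x_\ell) : \exists y\ \forall i\ (x_i,y)\in R_i\}.$$ (1) The projection width of $Q^\star_\ell$ is $\ell$. Here the projection width of a conjunctive query with free variables $F$ is defined as follows. Start from the multihypergraph whose hyperedges are the variable sets of the atoms, and repeatedly delete a variable outside $F$ that occurs in exactly one hyperedge, or a hyperedge contained in another one, until neither is possible. Join two of the remaining hyperedges by an edge if they share a variable outside $F$. The projection width is the largest number of hyperedges in a connected component of this graph. (2) $Q^\star_\ell$ can be evaluated in time $O\bigl(|D|+|D|\cdot|\mathrm{OUT}|^{1-1/\ell}\bigr)$ on a RAM with uniform cost measure. That is, there are a RAM program and constants $C,\kappa$, depending only on $\ell$, such that for every database $D$, presented as a list of the tuples of each relation, each once and in any order, preceded by their number, the program halts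 after at most $$C\cdot\max\bigl(1,\ |D|+|D|\cdot|\mathrm{OUT}|^{1-1/\ell}\bigr)$$ steps, having output every tuple of $\mathrm{OUT}$ exactly once, followed by the number $|\mathrm{OUT}|$. During the computation every register and memory cell holds a natural number less than $(N+2)^\kappa$, i.e. of $O(\log N)$ bits, whenever $N$ is an upper bound for $|D|$ and for all constants in $D$. (The RAM has registers and an indirectly addressed memory, all initially zero. Addition, truncated subtraction, multiplication, integer division, setting a constant, loading, storing, reading an input word, writing an output word, and jumps, unconditional or on comparing two registers, each cost one step.) -/

import Mathlib

namespace CQEval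

/-! ### Conjunctive queries -/

/-- A conjunctive query `Q(x_F) ← ⋀_{a} R_a(x_{J_a})` with variables `0, …, n-1` and `m` atoms.
`atom a` is the set `J_a` of variables of the `a`-th atom, `free` is the set `F` of variables
in the head. -/
structure CQ (n m : ℕ) where
  atom : Fin m → Finset (Fin n)
  free : Finset (Fin n)

/-- The star query `Q(x_1, …, x_ℓ) ← R_1(x_1, y) ∧ … ∧ R_ℓ(x_ℓ, y)`; the variable `y` is the last
one, and the variables `x_1, …, x_ℓ` are the others. -/
def starQuery (ℓ : ℕ) : CQ (ℓ + 1) ℓ where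
  atom i := {i.castSucc, Fin.last ℓ}
  free := Finset.univ.erase (Fin.last ℓ)

/-- Tuples over the schema `S`; the domain of constants is `ℕ`. -/
abbrev Tuple {n : ℕ} (S : Finset (Fin n)) : Type := S → ℕ

/-- The restriction of a valuation of all variables to the schema `S`. -/
def restrict {n : ℕ} (S : Finset (Fin n)) (v : Fin n → ℕ) : Tuple S := fun x => v x

/-- A database for `Q`: one finite relation for each atom. -/
abbrev CQ.Database {n m : ℕ} (Q : CQ n m) : Type := (a : Fin m) → Finset (Tuple (Q.atom a))

/-- The size `|D|` of a database: the total number of its tuples. -/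
def CQ.size {n m : ℕ} (Q : CQ n m) (D : Q.Database) : ℕ := ∑ a, (D a).card

/-- The result `OUT = Q(D)`: the restrictions to the free variables of the valuations whose
restriction to the schema of each atom belongs to the relation of that atom. -/
def CQ.answers {n m : ℕ} (Q : CQ n m) (D : Q.Database) : Set (Tuple Q.free) :=
  {u | ∃ v : Fin n → ℕ, (∀ a, restrict (Q.atom a) v ∈ D a) ∧ restrict Q.free v = u}

/-! ### Projection width -/

/-- A multihypergraph on the vertices `0, …, n-1`: its hyperedges are the sets `edge a` for
`a ∈ alive`. -/
structure MultiHypergraph (n m : ℕ) where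
  alive : Finset (Fin m)
  edge : Fin m → Finset (Fin n)

/-- The multihypergraph of a query. -/
def CQ.hypergraph {n m : ℕ} (Q : CQ n m) : MultiHypergraph n m where
  alive := Finset.univ
  edge := Q.atom

/-- One step of the reduction (a variant of the GYO algorithm): delete a variable that is not free
and occurs in exactly one hyperedge, or delete a hyperedge that is contained in another one. -/
inductive ReductionStep {n m : ℕ} (F : Finset (Fin n)) :
    MultiHypergraph n m → MultiHypergraph n m → Prop
  | removeVariable (H : MultiHypergraph n m) (x : Fin n) (a : Fin m) (hx : x ∉ F)
      (ha : a ∈ H.alive) (hxa : x ∈ H.edge a) (hiso : ∀ b ∈ H.alive, x ∈ H.edge b → b = a) :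
      ReductionStep F H ⟨H.alive, Function.update H.edge a ((H.edge a).erase x)⟩
  | removeEdge (H : MultiHypergraph n m) (a b : Fin m) (ha : a ∈ H.alive) (hb : b ∈ H.alive)
      (hab : a ≠ b) (hsub : H.edge a ⊆ H.edge b) :
      ReductionStep F H ⟨H.alive.erase a, H.edge⟩

/-- `H` is the hypergraph of the reduced query of `Q`: it arises from the hypergraph of `Q` by
reduction steps, and no further step is possible. -/
def CQ.IsReduction {n m : ℕ} (Q : CQ n m) (H : MultiHypergraph n m) : Prop :=
  Relation.ReflTransGen (ReductionStep Q.free) Q.hypergraph H ∧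
    ∀ H', ¬ ReductionStep Q.free H H'

/-- The graph whose vertices are the hyperedges, two of them adjacent if they share a variable
that is not free. -/
def MultiHypergraph.existsGraph {n m : ℕ} (H : MultiHypergraph n m) (F : Finset (Fin n)) :
    SimpleGraph H.alive where
  Adj a b := a ≠ b ∧ ∃ x, x ∉ F ∧ x ∈ H.edge a ∧ x ∈ H.edge b
  symm := ⟨fun _ _ h => ⟨h.1.symm, h.2.imp fun _ hx => ⟨hx.1, hx.2.2, hx.2.1⟩⟩⟩
  loopless := ⟨fun _ h => h.1 rfl⟩

/-- The projection width of `Q` is `k`: the largest number of atoms in a connected component of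
that graph, for the reduced query, is `k`. (All maximal sequences of reduction steps are required
to give this value.) -/
def CQ.HasProjectionWidth {n m : ℕ} (Q : CQ n m) (k : ℕ) : Prop :=
  (∃ H, Q.IsReduction H) ∧
    ∀ H, Q.IsReduction H →
      IsGreatest (Set.range fun c : (H.existsGraph Q.free).ConnectedComponent => c.supp.ncard) k

/-! ### Random access machines with uniform cost -/

/-- Instructions of the machine. `reg r` is the content of register `r`, `mem p` that of the memory
cell with address `p`. -/
inductive Instr
  /-- `reg d := c` -/
  | const (d c : ℕ)
  /-- `reg d := reg a + reg b` -/
  | add (d a b : ℕ)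
  /-- `reg d := reg a - reg b` (zero if the difference is negative) -/
  | sub (d a b : ℕ)
  /-- `reg d := reg a * reg b` -/
  | mul (d a b : ℕ)
  /-- `reg d := ⌊reg a / reg b⌋` (zero if the divisor is zero) -/
  | div (d a b : ℕ)
  /-- `reg d := mem (reg a)` -/
  | load (d a : ℕ)
  /-- `mem (reg a) := reg b` -/
  | store (a b : ℕ)
  /-- `reg d :=` the next word of the input tape (zero at the end of the tape) -/
  | read (d : ℕ)
  /-- append `reg a` to the output tape -/
  | write (a : ℕ)
  /-- continue with instruction number `p` -/
  | jump (p : ℕ)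
  /-- continue with instruction number `p` if `reg a < reg b` -/
  | jumpLt (a b p : ℕ)

/-- A program is a finite list of instructions, numbered from zero. -/
abbrev Program : Type := List Instr

/-- A configuration: program counter, registers, memory, rest of the (read-only) input tape,
content of the (write-only) output tape. -/
structure Config where
  pc : ℕ
  reg : ℕ → ℕ
  mem : ℕ → ℕ
  inp : List ℕ
  out : List ℕ

/-- At the start all registers and memory cells are zero and the output tape is empty. -/
def Config.init (w : List ℕ) : Config := ⟨0, fun _ => 0, fun _ => 0, w, []⟩

/-- Go to the next instruction after setting register `d` to `x`. -/
def Config.setReg (c : Config) (d x : ℕ) : Config :=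
  { c with pc := c.pc + 1, reg := Function.update c.reg d x }

/-- The effect of one instruction. -/
def Instr.exec : Instr → Config → Config
  | const d x, c => c.setReg d x
  | add d a b, c => c.setReg d (c.reg a + c.reg b)
  | sub d a b, c => c.setReg d (c.reg a - c.reg b)
  | mul d a b, c => c.setReg d (c.reg a * c.reg b)
  | div d a b, c => c.setReg d (c.reg a / c.reg b)
  | load d a, c => c.setReg d (c.mem (c.reg a))
  | store a b, c => { c with pc := c.pc + 1, mem := Function.update c.mem (c.reg a) (c.reg b) }
  | read d, c => { c.setReg d (c.inp.headD 0) with inp := c.inp.tail }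
  | write a, c => { c with pc := c.pc + 1, out := c.out ++ [c.reg a] }
  | jump p, c => { c with pc := p }
  | jumpLt a b p, c => { c with pc := if c.reg a < c.reg b then p else c.pc + 1 }

/-- The machine halts when the program counter leaves the program. -/
def Halted (P : Program) (c : Config) : Prop := P.length ≤ c.pc

/-- One step, of cost one; a halted machine does not move. -/
def step (P : Program) (c : Config) : Config :=
  match P[c.pc]? with
  | some i => i.exec c
  | none => c

/-- The configuration after `t` steps on the input tape `w`. -/
def run (P : Program) (w : List ℕ) (t : ℕ) : Config := (step P)^[t] (Config.init w)

/-! ### Evaluating a query on the machine -/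

/-- A tuple is written as the list of its values, in the order of the variables. -/
def encodeTuple {n : ℕ} {S : Finset (Fin n)} (u : Tuple S) : List ℕ :=
  List.ofFn fun j : Fin S.card => u (S.orderIsoOfFin rfl j)

/-- `L` lists every element of `s` exactly once, in some order. -/
def Lists {α : Type} (L : List α) (s : Set α) : Prop := L.Nodup ∧ ∀ u, u ∈ L ↔ u ∈ s

/-- `w` is an encoding of `D`: for one atom after the other, the number of tuples of the relation,
followed by its tuples, each of them once, in an arbitrary order. -/
def CQ.EncodesDatabase {n m : ℕ} (Q : CQ n m) (D : Q.Database) (w : List ℕ) : Prop :=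
  ∃ L : (a : Fin m) → List (Tuple (Q.atom a)), (∀ a, Lists (L a) (D a : Set _)) ∧
    w = (List.ofFn fun a => (L a).length :: (L a).flatMap encodeTuple).flatten

/-- `w` is an encoding of the result: its tuples, each of them once, in an arbitrary order,
followed by their number. -/
def CQ.EncodesAnswers {n m : ℕ} (Q : CQ n m) (D : Q.Database) (w : List ℕ) : Prop :=
  ∃ L : List (Tuple Q.free), Lists L (Q.answers D) ∧ w = L.flatMap encodeTuple ++ [L.length]

/-- `Q` can be evaluated in time `O(T(|D|, |OUT|))` on a random access machine with uniform cost
whose words have `O(log N)` bits, where `N` bounds the size of the instance and its constants: one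
program computes `Q(D)` for all databases `D`, within `C * T(|D|, |OUT|)` steps, and all registers
and memory cells stay below `(N + 2) ^ κ`, with constants `C` and `κ` that depend on `Q` only.
(The `max` with `1` allows for the constant number of steps that is needed when `T` is zero, as it
may be for the empty database.) -/
def CQ.EvaluableInTime {n m : ℕ} (Q : CQ n m) (T : ℕ → ℕ → ℝ) : Prop :=
  ∃ (P : Program) (C : ℝ) (κ : ℕ), ∀ (D : Q.Database) (w : List ℕ), Q.EncodesDatabase D w →
    ∃ t : ℕ, Halted P (run P w t) ∧
      Q.EncodesAnswers D (run P w t).out ∧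
      (t : ℝ) ≤ C * max 1 (T (Q.size D) (Q.answers D).ncard) ∧
      ∀ N : ℕ, Q.size D ≤ N → (∀ a, ∀ u ∈ D a, ∀ x, u x ≤ N) →
        ∀ s ≤ t, ∀ p : ℕ, (run P w s).reg p < (N + 2) ^ κ ∧ (run P w s).mem p < (N + 2) ^ κ

end CQEval

namespace CQEval

/-! ### A structured language on top of the machine -/

/-! For a value y let p be the product and q the sum of the sizes of the ℓ fibres of the relations
over y. The p combinations of fibre elements are distinct answers, so p ≤ |OUT|; and p ≤ q^ℓ, since
no factor exceeds q. Hence p = p^(1/ℓ) · p^(1-1/ℓ) ≤ q · |OUT|^(1-1/ℓ). The numbers q add up to |D|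
over all y, so there are at most |D| · |OUT|^(1-1/ℓ) combinations altogether
(`prod_length_fiber_le`, `le_mul_rpow_of_le_pow`, `sum_join_le`).

The naive join is therefore fast enough, provided that each combination costs constant time for
fixed ℓ. `Cmd.starJoin` stores all relations but the last as lists indexed by y, streams the last
one, and obtains the combinations for a tuple by decoding one counter in mixed radix
(`exists_digit_eq`, `joins_iff`). Duplicates, which come from different y, are suppressed by a mark
at an address computed injectively from the answer; as memory is initially zero, this test takes
constant time (`WP.emit`). Addresses are iterated pairings of boundedly many numbers, hence
polynomial in N (`exists_wordBound`).

Execution is verified with total correctness rules for a small structured language compiled to the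
machine; `WP` carries the elapsed time and the word bound along.

For the projection width: if ℓ ≥ 2, no reduction step applies, because y lies in every atom and each
atom has a private free variable; all atoms share y, so the graph is complete. If ℓ = 1, there is
one atom throughout. -/

/-- The state of the machine without its program counter, together with the elapsed time. -/
structure State where
  reg : ℕ → ℕ
  mem : ℕ → ℕ
  inp : List ℕ
  out : List ℕ
  time : ℕ

/-- The configuration with program counter `p`. -/
def State.config (s : State) (p : ℕ) : Config := ⟨p, s.reg, s.mem, s.inp, s.out⟩

/-- Assign `x` to register `d` in one step. -/
@[simps] def State.set (s : State) (d x : ℕ) : State :=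
  { s with reg := Function.update s.reg d x, time := s.time + 1 }

/-- Assign `x` to the memory cell with address `q` in one step. -/
@[simps] def State.setMem (s : State) (q x : ℕ) : State :=
  { s with mem := Function.update s.mem q x, time := s.time + 1 }

/-- Assign `x` to register `d` in one step and continue with the input tape `l`. -/
@[simps] def State.input (s : State) (d x : ℕ) (l : List ℕ) : State :=
  { s with reg := Function.update s.reg d x, inp := l, time := s.time + 1 }

/-- Append `x` to the output tape in one step. -/
@[simps] def State.output (s : State) (x : ℕ) : State :=
  { s with out := s.out ++ [x], time := s.time + 1 }

/-- Let `t` steps pass. -/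
@[simps] def State.wait (s : State) (t : ℕ) : State := { s with time := s.time + t }

@[simp] theorem State.mem_set (s : State) (d x : ℕ) : (s.set d x).mem = s.mem := rfl

@[simp] theorem State.mem_setMem (s : State) (q x : ℕ) :
    (s.setMem q x).mem = Function.update s.mem q x := rfl

@[simp] theorem State.mem_input (s : State) (d x : ℕ) (l : List ℕ) :
    (s.input d x l).mem = s.mem := rfl

@[simp] theorem State.mem_output (s : State) (x : ℕ) : (s.output x).mem = s.mem := rfl

@[simp] theorem State.mem_wait (s : State) (t : ℕ) : (s.wait t).mem = s.mem := rfl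

/-- Structured programs. The instruction of `op` is not meant to be a jump. -/
inductive Cmd
  | skip
  | op (i : Instr)
  | seq (c d : Cmd)
  | whileLt (a b : ℕ) (c : Cmd)
  | unlessLt (a b : ℕ) (c : Cmd)

infixr:60 " ;; " => Cmd.seq

/-- The number of instructions that a structured program is translated to. -/
def Cmd.size : Cmd → ℕ
  | skip => 0
  | op _ => 1
  | seq c d => c.size + d.size
  | whileLt _ _ c => c.size + 3
  | unlessLt _ _ c => c.size + 1

/-- The machine code of a structured program, for the position `p`. -/
def Cmd.compile : Cmd → ℕ → Program
  | skip, _ => []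
  | op i, _ => [i]
  | seq c d, p => c.compile p ++ d.compile (p + c.size)
  | whileLt a b c, p =>
      .jumpLt a b (p + 2) :: .jump (p + (c.size + 3)) :: (c.compile (p + 2) ++ [.jump p])
  | unlessLt a b c, p => .jumpLt a b (p + (c.size + 1)) :: c.compile (p + 1)

theorem Cmd.length_compile (c : Cmd) (p : ℕ) : (c.compile p).length = c.size := by
  induction c generalizing p <;> simp_all [Cmd.compile, Cmd.size]

/-- The code `l` stands at position `p` of the program `P`. -/
def CodeAt (P : Program) : ℕ → Program → Prop
  | _, [] => True
  | p, i :: l => P[p]? = some i ∧ CodeAt P (p + 1) l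

theorem codeAt_append {P : Program} {p : ℕ} {l l' : Program} :
    CodeAt P p (l ++ l') ↔ CodeAt P p l ∧ CodeAt P (p + l.length) l' := by
  induction l generalizing p with
  | nil => simp [CodeAt]
  | cons i l ih => simp [CodeAt, ih, and_assoc, Nat.add_assoc, Nat.add_comm 1]

theorem codeAt_self (P : Program) : CodeAt P 0 P := by
  -- The induction needs a prefix of instructions already passed; its length is the position.
  suffices h : ∀ l pre : Program, CodeAt (pre ++ l) pre.length l from h P []
  intro l
  induction l with
  | nil => intro _; trivial
  | cons i l ih =>
    intro pre
    refine ⟨by simp, ?_⟩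
    simpa using ih (pre ++ [i])

/-- On the input `w`, the program `P` arrives at position `p` in the state `s`, and up to then all
registers and memory cells are smaller than `B`. -/
def Arrives (P : Program) (w : List ℕ) (B p : ℕ) (s : State) : Prop :=
  run P w s.time = s.config p ∧
    ∀ u ≤ s.time, ∀ q, (run P w u).reg q < B ∧ (run P w u).mem q < B

/-- Weakest preconditions: started in the state `s`, the command `c` terminates in a state that
satisfies `Q`, and all registers and memory cells stay below `B`. -/
def WP (w : List ℕ) (B : ℕ) (c : Cmd) (s : State) (Q : State → Prop) : Prop :=
  ∀ P p, CodeAt P p (c.compile p) → Arrives P w B p s →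
    ∃ s', Q s' ∧ Arrives P w B (p + c.size) s'

/-! ### Proof rules for the structured language -/

variable {w : List ℕ} {B : ℕ}

theorem Arrives.step {P : Program} {p p' : ℕ} {s s' : State} {i : Instr}
    (h : Arrives P w B p s) (hi : P[p]? = some i) (hs : i.exec (s.config p) = s'.config p')
    (ht : s'.time = s.time + 1) (hB : ∀ q, s'.reg q < B ∧ s'.mem q < B) :
    Arrives P w B p' s' := by
  have h1 : run P w s'.time = s'.config p' := by
    have h2 := h.1
    rw [run] at h2
    rw [run, ht, Function.iterate_succ_apply', h2, ← hs]
    simp [CQEval.step, State.config, hi]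
  refine ⟨h1, fun u hu q => ?_⟩
  rcases Nat.lt_or_ge s.time u with h3 | h3
  · obtain rfl : u = s'.time := by omega
    rw [h1]
    exact hB q
  · exact h.2 u h3 q

theorem Arrives.bound {P : Program} {p : ℕ} {s : State} (h : Arrives P w B p s) (q : ℕ) :
    s.reg q < B ∧ s.mem q < B := by
  have := h.2 _ le_rfl q
  rwa [h.1] at this

theorem Arrives.tick {P : Program} {p p' : ℕ} {s : State} {i : Instr}
    (h : Arrives P w B p s) (hi : P[p]? = some i) (hs : i.exec (s.config p) = s.config p') :
    Arrives P w B p' (s.wait 1) :=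
  h.step hi hs rfl h.bound

/-- Arrival at the start of the command already includes the word bound there. This serves
intermediate values that are dominated by a register. -/
theorem WP.of_bound {c : Cmd} {s : State} {Q : State → Prop}
    (h : (∀ q, s.reg q < B ∧ s.mem q < B) → WP w B c s Q) : WP w B c s Q :=
  fun P p hc hs => h hs.bound P p hc hs

theorem WP.mono {c : Cmd} {s : State} {Q Q' : State → Prop} (h : WP w B c s Q)
    (hQ : ∀ s', Q s' → Q' s') : WP w B c s Q' := fun P p hc hs =>
  let ⟨s', h1, h2⟩ := h P p hc hs
  ⟨s', hQ s' h1, h2⟩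

theorem WP.skip {s : State} {Q : State → Prop} (h : Q s) : WP w B .skip s Q :=
  fun _ _ _ hs => ⟨s, h, hs⟩

theorem WP.seq {c d : Cmd} {s : State} {Q : State → Prop}
    (h : WP w B c s fun s' => WP w B d s' Q) : WP w B (c ;; d) s Q := by
  intro P p hc hs
  rw [Cmd.compile, codeAt_append, Cmd.length_compile] at hc
  obtain ⟨s1, h1, h2⟩ := h P p hc.1 hs
  obtain ⟨s2, h3, h4⟩ := h1 P _ hc.2 h2
  exact ⟨s2, h3, by rwa [Nat.add_assoc] at h4⟩

theorem WP.op {i : Instr} {s s' : State} {Q : State → Prop} (hQ : Q s')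
    (hs : ∀ p, i.exec (s.config p) = s'.config (p + 1)) (ht : s'.time = s.time + 1)
    (hB : (∀ q, s.reg q < B ∧ s.mem q < B) → ∀ q, s'.reg q < B ∧ s'.mem q < B) :
    WP w B (.op i) s Q :=
  fun _ p hc h => ⟨s', hQ, h.step hc.1 (hs p) ht (hB h.bound)⟩

theorem WP.set {i : Instr} {s : State} {d x : ℕ} {Q : State → Prop}
    (hi : ∀ p, i.exec (s.config p) = (s.config p).setReg d x)
    (hx : (∀ q, s.reg q < B ∧ s.mem q < B) → x < B) (hQ : Q (s.set d x)) :
    WP w B (.op i) s Q := by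
  refine WP.op hQ hi rfl fun h q => ⟨?_, (h q).2⟩
  by_cases hq : q = d
  · subst hq; simpa using hx h
  · simpa [hq] using (h q).1

variable {s : State} {Q : State → Prop} {d a b x : ℕ}

theorem WP.const (hx : x < B) (hQ : Q (s.set d x)) : WP w B (.op (.const d x)) s Q :=
  WP.set (fun _ => rfl) (fun _ => hx) hQ

theorem WP.add (hx : s.reg a + s.reg b < B) (hQ : Q (s.set d (s.reg a + s.reg b))) :
    WP w B (.op (.add d a b)) s Q :=
  WP.set (fun _ => rfl) (fun _ => hx) hQ

theorem WP.mul (hx : s.reg a * s.reg b < B) (hQ : Q (s.set d (s.reg a * s.reg b))) :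
    WP w B (.op (.mul d a b)) s Q :=
  WP.set (fun _ => rfl) (fun _ => hx) hQ

/-- A difference is at most its minuend, so no new bound has to be checked; likewise for quotients,
loads and stores. Only constants, sums, products and input words can exceed the bound. -/
theorem WP.sub (hQ : Q (s.set d (s.reg a - s.reg b))) : WP w B (.op (.sub d a b)) s Q :=
  WP.set (fun _ => rfl) (fun h => (Nat.sub_le _ _).trans_lt (h a).1) hQ

theorem WP.div (hQ : Q (s.set d (s.reg a / s.reg b))) : WP w B (.op (.div d a b)) s Q :=
  WP.set (fun _ => rfl) (fun h => (Nat.div_le_self _ _).trans_lt (h a).1) hQ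

theorem WP.load (hQ : Q (s.set d (s.mem (s.reg a)))) : WP w B (.op (.load d a)) s Q :=
  WP.set (fun _ => rfl) (fun h => (h _).2) hQ

theorem WP.store (hQ : Q (s.setMem (s.reg a) (s.reg b))) :
    WP w B (.op (.store a b)) s Q := by
  refine WP.op hQ (fun _ => rfl) rfl fun h q => ⟨(h q).1, ?_⟩
  by_cases hq : q = s.reg a
  · subst hq; simpa using (h b).1
  · simpa [hq] using (h q).2

theorem WP.read {l : List ℕ} (hs : s.inp = x :: l) (hx : x < B)
    (hQ : Q (s.input d x l)) : WP w B (.op (.read d)) s Q := by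
  refine WP.op hQ (fun p => ?_) rfl fun h q => ⟨?_, (h q).2⟩
  · simp [Instr.exec, State.config, Config.setReg, State.input, hs]
  · by_cases hq : q = d
    · subst hq; simpa using hx
    · simpa [hq] using (h q).1

theorem WP.write (hQ : Q (s.output (s.reg a))) :
    WP w B (.op (.write a)) s Q :=
  WP.op hQ (fun _ => rfl) rfl fun h => h

/-- The invariant is indexed by the number of remaining rounds, which gives termination. A round
costs the test and the jump back; leaving costs the failed test and the jump out. -/
theorem WP.whileLt {c : Cmd} (Inv : ℕ → State → Prop) {n : ℕ} (h0 : Inv n s)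
    (hstep : ∀ k s, Inv (k + 1) s → s.reg a < s.reg b ∧
      WP w B c (s.wait 1) fun s' => Inv k (s'.wait 1))
    (hend : ∀ s, Inv 0 s → s.reg b ≤ s.reg a ∧ Q (s.wait 2)) :
    WP w B (.whileLt a b c) s Q := by
  intro P p hc hs
  obtain ⟨hc1, hc2, hc3⟩ := hc
  rw [codeAt_append, Cmd.length_compile] at hc3
  induction n generalizing s with
  | zero =>
    obtain ⟨h1, h2⟩ := hend s h0
    refine ⟨_, h2, (hs.tick (p' := p + 1) hc1 ?_).tick hc2 rfl⟩
    simp [Instr.exec, State.config, Nat.not_lt.2 h1]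
  | succ k ih =>
    obtain ⟨h1, h2⟩ := hstep k s h0
    have h3 := hs.tick (p' := p + 2) hc1 (by simp [Instr.exec, State.config, h1])
    obtain ⟨s1, h4, h5⟩ := h2 P _ hc3.1 h3
    exact ih h4 (h5.tick hc3.2.1 rfl)

theorem WP.unlessLt {c : Cmd} (h1 : s.reg a < s.reg b → Q (s.wait 1))
    (h2 : s.reg b ≤ s.reg a → WP w B c (s.wait 1) Q) :
    WP w B (.unlessLt a b c) s Q := by
  intro P p hc hs
  obtain ⟨hc1, hc2⟩ := hc
  by_cases h : s.reg a < s.reg b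
  · exact ⟨_, h1 h, hs.tick hc1 (by simp [Instr.exec, State.config, h, Cmd.size])⟩
  · obtain ⟨s1, h4, h5⟩ := h2 (Nat.le_of_not_lt h) P _ hc2
      (hs.tick (p' := p + 1) hc1 (by simp [Instr.exec, State.config, h]))
    exact ⟨s1, h4, by rwa [Nat.add_assoc, Nat.add_comm 1] at h5⟩

/-- The commands `f 0, …, f (k - 1)` one after the other. -/
def Cmd.unroll (f : ℕ → Cmd) : ℕ → Cmd
  | 0 => .skip
  | k + 1 => unroll f k ;; f k

/-- Register numbers are fixed in the code, so iterations over the atoms are unrolled at compile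
time. The invariant is indexed by the number of commands done. -/
theorem WP.unroll {f : ℕ → Cmd} (Inv : ℕ → State → Prop) {k : ℕ} (h0 : Inv 0 s)
    (h : ∀ j < k, ∀ s, Inv j s → WP w B (f j) s (Inv (j + 1))) :
    WP w B (.unroll f k) s (Inv k) := by
  induction k with
  | zero => exact WP.skip h0
  | succ k ih =>
    exact WP.seq ((ih fun j hj => h j (by omega)).mono fun s' hs' => h k (by omega) s' hs')

/-- A program is run by compiling it at position `0`. -/
theorem WP.run_compile {c : Cmd} (h : WP w B c ⟨fun _ => 0, fun _ => 0, w, [], 0⟩ Q) (hB : 0 < B) :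
    ∃ s, Q s ∧ Halted (c.compile 0) (run (c.compile 0) w s.time) ∧
      (run (c.compile 0) w s.time).out = s.out ∧
      ∀ u ≤ s.time, ∀ q, (run (c.compile 0) w u).reg q < B ∧ (run (c.compile 0) w u).mem q < B := by
  obtain ⟨s, h1, h2, h3⟩ := h (c.compile 0) 0 (codeAt_self _) ⟨rfl, fun u hu q => by
    obtain rfl : u = 0 := by simpa using hu
    exact ⟨hB, hB⟩⟩
  refine ⟨s, h1, ?_, ?_, h3⟩
  · rw [h2, Halted, Cmd.length_compile]
    simp [State.config]
  · rw [h2]; rfl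

end CQEval

namespace CQEval

/-! ### Pairing, codes of lists, addresses -/

/-- An injective pairing function that takes three instructions. -/
def pairing (a b : ℕ) : ℕ := (a + b) * (a + b) + a

/-- The value lies in [(a+b)², (a+b+1)²), so it determines a + b, and then a. -/
theorem pairing_inj {a b c d : ℕ} : pairing a b = pairing c d ↔ a = c ∧ b = d := by
  refine ⟨fun h => ?_, by rintro ⟨rfl, rfl⟩; rfl⟩
  unfold pairing at h
  have h1 : a + b = c + d := by
    rcases lt_trichotomy (a + b) (c + d) with h1 | h1 | h1
    · nlinarith
    · exact h1
    · nlinarith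
  rw [h1] at h
  omega

theorem pairing_le_pairing {a b c d : ℕ} (h : a ≤ c) (h' : b ≤ d) : pairing a b ≤ pairing c d := by
  unfold pairing
  gcongr

theorem sq_add_le_pairing (a b : ℕ) : (a + b) * (a + b) ≤ pairing a b := Nat.le_add_right _ _

theorem add_le_pairing (a b : ℕ) : a + b ≤ pairing a b :=
  (Nat.le_mul_self _).trans (sq_add_le_pairing a b)

/-- The code of a list. -/
def listCode : List ℕ → ℕ := List.foldl pairing 0

theorem listCode_append_singleton (l : List ℕ) (x : ℕ) :
    listCode (l ++ [x]) = pairing (listCode l) x := by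
  simp [listCode]

/-- Peel off last elements with `pairing_inj`. Equal lengths are necessary: the pair of 0 and 0 is
0, so leading zeros are invisible. -/
theorem listCode_inj {l l' : List ℕ} (hl : l.length = l'.length) :
    listCode l = listCode l' ↔ l = l' := by
  refine ⟨fun h => ?_, by rintro rfl; rfl⟩
  induction l using List.reverseRecOn generalizing l' with
  | nil => simpa [eq_comm] using hl
  | append_singleton l x ih =>
    induction l' using List.reverseRecOn with
    | nil => simp at hl
    | append_singleton l' x' _ =>
      rw [listCode_append_singleton, listCode_append_singleton, pairing_inj] at h
      rw [ih (by simpa using hl) h.1, h.2]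

/-- The address of the entry number `k` of the row `y` of the table `i`. -/
def addr (i y k : ℕ) : ℕ := pairing (pairing i y) k

theorem addr_inj {i y k i' y' k' : ℕ} :
    addr i y k = addr i' y' k' ↔ (i = i' ∧ y = y') ∧ k = k' := by
  simp [addr, pairing_inj]

theorem addr_le_addr {i y k i' y' k' : ℕ} (hi : i ≤ i') (hy : y ≤ y') (hk : k ≤ k') :
    addr i y k ≤ addr i' y' k' :=
  pairing_le_pairing (pairing_le_pairing hi hy) hk

/-- The memory holds the lists `L i y` (preceded by their lengths) in the tables with positive
numbers, and the characteristic function of `S` in the table number `0`. -/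
structure MemOk (mem : ℕ → ℕ) (L : ℕ → ℕ → List ℕ) (S : Set ℕ) : Prop where
  length : ∀ i y, mem (addr (i + 1) y 0) = (L i y).length
  entry : ∀ i y k x, (L i y)[k]? = some x → mem (addr (i + 1) y (k + 1)) = x
  seen : ∀ c, 0 < mem (addr 0 c 0) ↔ c ∈ S

theorem memOk_zero : MemOk (fun _ => 0) (fun _ _ => []) ∅ := ⟨by simp, by simp, by simp⟩

/-- Cell 0 of a row is its length and entry k sits in cell k + 1, so the new element goes to the
cell numbered by the new length. Injectivity of addresses protects everything else. -/
theorem MemOk.append {mem : ℕ → ℕ} {L : ℕ → ℕ → List ℕ} {S : Set ℕ} (h : MemOk mem L S)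
    (i y x : ℕ) :
    MemOk (Function.update (Function.update mem (addr (i + 1) y 0) ((L i y).length + 1))
      (addr (i + 1) y ((L i y).length + 1)) x)
      (Function.update L i (Function.update (L i) y (L i y ++ [x]))) S := by
  refine ⟨fun i' y' => ?_, fun i' y' k x' hx => ?_, fun c => ?_⟩
  · by_cases hi : i' = i
    · subst hi
      by_cases hy : y' = y
      · subst hy
        simp [addr_inj]
      · simp [addr_inj, hy, h.length]
    · simp [addr_inj, hi, h.length]
  · by_cases hi : i' = i
    · subst hi
      by_cases hy : y' = y
      · subst hy
        rcases Nat.lt_trichotomy k (L i' y').length with hk | hk | hk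
        · have h1 := h.entry i' y' k x' (by simpa [List.getElem?_append_left hk] using hx)
          simp [addr_inj, hk.ne, h1]
        · subst hk
          simp at hx
          simp [hx]
        · rw [List.getElem?_eq_none] at hx
          · cases hx
          · simpa using hk
      · simp [addr_inj, hy] at hx ⊢
        exact h.entry _ _ _ _ hx
    · simp [addr_inj, hi] at hx ⊢
      exact h.entry _ _ _ _ hx
  · simpa [Function.update_apply, addr_inj] using h.seen c

theorem MemOk.mark {mem : ℕ → ℕ} {L : ℕ → ℕ → List ℕ} {S : Set ℕ} (h : MemOk mem L S) (c : ℕ) :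
    MemOk (Function.update mem (addr 0 c 0) 1) L (insert c S) := by
  refine ⟨fun i y => ?_, fun i y k x hx => ?_, fun c' => ?_⟩
  · simpa [Function.update_apply, addr_inj] using h.length i y
  · simpa [Function.update_apply, addr_inj] using h.entry i y k x hx
  · by_cases hc : c' = c
    · simp [hc]
    · simpa [Function.update_apply, addr_inj, hc] using h.seen c'

/-! ### Reading relations into tables -/

variable {w : List ℕ} {B : ℕ} {s : State} {Q : State → Prop}

/-- Register `d` becomes the pair of the registers `a` and `b`; register `4` is used. -/
def Cmd.pair (d a b : ℕ) : Cmd := .op (.add 4 a b) ;; .op (.mul 4 4 4) ;; .op (.add d 4 a)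

/-- The final pair dominates the intermediate sum and square, so one bound suffices. Register `a` is
read again after register 4 was overwritten, hence `a ≠ 4`. -/
theorem WP.pair {d a b : ℕ} (ha : a ≠ 4) (hB : pairing (s.reg a) (s.reg b) < B)
    (hQ : Q (((s.set 4 (s.reg a + s.reg b)).set 4 ((s.reg a + s.reg b) * (s.reg a + s.reg b))).set d
      (pairing (s.reg a) (s.reg b)))) : WP w B (.pair d a b) s Q := by
  refine WP.seq (WP.add ((add_le_pairing _ _).trans_lt hB) (WP.seq (WP.mul ?_ (WP.add ?_ ?_))))
  · simpa using (sq_add_le_pairing _ _).trans_lt hB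
  · simpa [ha, pairing] using hB
  · simpa [ha, pairing] using hQ

/-- Read a relation and store it in the table number `i + 1`: first the number of its tuples, then
its tuples `(x, y)`; the `x` are appended to the row `y`. -/
def Cmd.readTable (i : ℕ) : Cmd :=
  .op (.read 2) ;;
  .whileLt 0 2 (
    .op (.read 16) ;; .op (.read 3) ;; .op (.const 7 (i + 1)) ;;
    .pair 5 7 3 ;; .pair 6 5 0 ;; .op (.load 8 6) ;; .op (.add 8 8 1) ;; .op (.store 6 8) ;;
    .pair 5 5 8 ;; .op (.store 5 16) ;; .op (.sub 2 2 1))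

/-- The encoding of a binary relation. -/
def pairsInput (l : List (ℕ × ℕ)) : List ℕ := l.flatMap fun t => [t.1, t.2]

/-- The first components of the pairs with second component `y`. -/
def fiber (l : List (ℕ × ℕ)) (y : ℕ) : List ℕ := (l.filter fun t => t.2 = y).map Prod.fst

theorem fiber_append_singleton (l : List (ℕ × ℕ)) (t : ℕ × ℕ) :
    fiber (l ++ [t]) = Function.update (fiber l) t.2 (fiber l t.2 ++ [t.1]) := by
  funext y
  by_cases h : y = t.2
  · subst h; simp [fiber]
  · simp [fiber, h, Ne.symm h]

theorem length_fiber_le (l : List (ℕ × ℕ)) (y : ℕ) : (fiber l y).length ≤ l.length := by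
  simpa [fiber] using List.length_filter_le _ l

theorem mem_fiber {l : List (ℕ × ℕ)} {x y : ℕ} : x ∈ fiber l y ↔ (x, y) ∈ l := by
  simp [fiber]

/-- The stored length of a row points to its next free cell, so each tuple is filed in constant
time: 17 instructions plus 2 for the loop. -/
theorem WP.readTable {i b : ℕ} {l : List (ℕ × ℕ)} {rest : List ℕ} {L : ℕ → ℕ → List ℕ} {S : Set ℕ}
    (hb : addr b b b < B) (hi : i + 1 ≤ b) (hl : l.length ≤ b) (hlb : ∀ t ∈ l, t.1 ≤ b ∧ t.2 ≤ b)
    (hinp : s.inp = l.length :: (pairsInput l ++ rest)) (h0 : s.reg 0 = 0) (h1 : s.reg 1 = 1)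
    (hmem : MemOk s.mem L S) (hL : L i = fun _ => []) :
    WP w B (.readTable i) s fun s' => s'.inp = rest ∧ s'.out = s.out ∧ s'.reg 0 = 0 ∧ s'.reg 1 = 1 ∧
      s'.reg 10 = s.reg 10 ∧ s'.time = s.time + 3 + 19 * l.length ∧
      MemOk s'.mem (Function.update L i (fiber l)) S := by
  have hbB : pairing b b < B := lt_of_le_of_lt ((Nat.le_add_right _ _).trans (add_le_pairing _ _)) hb
  have hbB' : b < B := lt_of_le_of_lt ((Nat.le_add_right _ _).trans (add_le_pairing _ _)) hbB
  refine WP.seq (WP.read hinp (by omega) ?_)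
  refine WP.whileLt (n := l.length) (fun k s' => ∃ pre suf, l = pre ++ suf ∧ suf.length = k ∧
    s'.inp = pairsInput suf ++ rest ∧ s'.reg 2 = k ∧ s'.out = s.out ∧ s'.reg 0 = 0 ∧ s'.reg 1 = 1 ∧
    s'.reg 10 = s.reg 10 ∧ s'.time = s.time + 1 + 19 * pre.length ∧
    MemOk s'.mem (Function.update L i (fiber pre)) S) ?_ ?_ ?_
  · refine ⟨[], l, by simp, rfl, rfl, by simp, rfl, by simp [h0], by simp [h1], by simp, by simp, ?_⟩
    rwa [show Function.update L i (fiber []) = L from Function.update_eq_self_iff.2 hL.symm]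
  · rintro k s' ⟨pre, suf, rfl, hk, hi1, h2, ho, h0', h1', h10, ht, hm⟩
    refine ⟨by omega, ?_⟩
    obtain _ | ⟨⟨x, y⟩, suf⟩ := suf
    · simp at hk
    have hxy := hlb (x, y) (by simp)
    -- The current tuple is not yet in `pre`, which leaves room for one more element below the
    -- bound.
    have hlen : (fiber pre y).length + 1 ≤ b := by
      have := length_fiber_le pre y
      simp at hl
      omega
    have hcnt := hm.length i y
    simp only [Function.update_self] at hcnt
    refine WP.seq (WP.read (x := x) (l := y :: (pairsInput suf ++ rest))
      (by simp [hi1, pairsInput]) (by simp_all; omega) ?_)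
    refine WP.seq (WP.read rfl (by simp_all; omega) ?_)
    refine WP.seq (WP.const (by omega) ?_)
    refine WP.seq (WP.pair (by decide) ?_ ?_)
    · exact (pairing_le_pairing (by simpa using hi) (by simpa using hxy.2)).trans_lt hbB
    refine WP.seq (WP.pair (by decide) ?_ ?_)
    · exact (addr_le_addr (i' := b) (y' := b) (k' := b) (by simpa using hi) (by simpa using hxy.2)
        (by simp [h0'])).trans_lt hb
    refine WP.seq (WP.load ?_)
    refine WP.seq (WP.add ?_ ?_)
    · simp [h1', h0', ← addr.eq_1, hcnt]; omega
    refine WP.seq (WP.store ?_)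
    refine WP.seq (WP.pair (by decide) ?_ ?_)
    · refine (addr_le_addr (i' := b) (y' := b) (k' := b) (by simpa using hi) (by simpa using hxy.2)
        ?_).trans_lt hb
      simpa [h1', h0', ← addr.eq_1, hcnt] using hlen
    refine WP.seq (WP.store (WP.sub ?_))
    refine ⟨pre ++ [(x, y)], suf, by simp, by simpa using hk, by simp, ?_, ?_, ?_, ?_, ?_, ?_, ?_⟩
    · simp [h2, h1']
    · simp [ho]
    · simp [h0']
    · simp [h1']
    · simp [h10]
    · simp [ht]; omega
    · have := hm.append i y x
      rw [Function.update_self, Function.update_idem] at this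
      rw [fiber_append_singleton]
      convert this using 1
      simp [h1', h0', ← addr.eq_1, hcnt]
  · rintro s' ⟨pre, suf, rfl, hk, hi1, h2, ho, h0', h1', h10, ht, hm⟩
    obtain rfl : suf = [] := List.length_eq_zero_iff.1 hk
    refine ⟨by omega, by simpa [pairsInput] using hi1, ho, h0', h1', h10, ?_, by simpa using hm⟩
    simp [ht]; omega

end CQEval

namespace CQEval

/-! ### Mixed radix numbers -/

/-- The digit number `k` of `j`, for the radices `d 0, d 1, …`. -/
def digit (d : ℕ → ℕ) (j k : ℕ) : ℕ := j / (∏ i ∈ Finset.range k, d i) % d k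

/-- Add the new digit times the product of the earlier radices. Only existence matters: repeated
combinations would be filtered out anyway. -/
theorem exists_digit_eq (d a : ℕ → ℕ) (m : ℕ) (h : ∀ k < m, a k < d k) :
    ∃ j < ∏ i ∈ Finset.range m, d i, ∀ k < m, digit d j k = a k := by
  induction m with
  | zero => simp
  | succ m ih =>
    obtain ⟨j, hj, hd⟩ := ih fun k hk => h k (by omega)
    have ham := h m (by omega)
    refine ⟨j + (∏ i ∈ Finset.range m, d i) * a m, ?_, fun k hk => ?_⟩
    · rw [Finset.prod_range_succ]
      nlinarith
    · rcases Nat.lt_succ_iff_lt_or_eq.1 hk with hk | rfl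
      -- The added term is a multiple of the product of the first k + 1 radices, so it does not
      -- affect digit k.
      · obtain ⟨c, hc⟩ : (∏ i ∈ Finset.range (k + 1), d i) ∣ ∏ i ∈ Finset.range m, d i :=
          Finset.prod_dvd_prod_of_subset _ _ _ (Finset.range_subset_range.2 hk)
        have hpos : 0 < ∏ i ∈ Finset.range k, d i :=
          Finset.prod_pos fun i hi => (Nat.zero_le _).trans_lt (h i (by simp at hi; omega))
        rw [← hd k hk, digit, digit, hc, Finset.prod_range_succ, Nat.mul_assoc, Nat.mul_assoc,
          Nat.add_mul_div_left _ _ hpos, Nat.add_mul_mod_self_left]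
      · rw [digit, Nat.add_mul_div_left _ _ (by omega), Nat.div_eq_of_lt hj, Nat.zero_add,
          Nat.mod_eq_of_lt ham]

/-- Such lists are functions from `Fin n` to b + 1 values. This keeps the answer counter below the
word bound. -/
theorem length_le_of_nodup {E : List (List ℕ)} {b n : ℕ} (hE : E.Nodup)
    (h : ∀ e ∈ E, e.length = n ∧ ∀ x ∈ e, x ≤ b) : E.length ≤ (b + 1) ^ n := by
  let S : Finset (List ℕ) := (Fintype.piFinset fun _ : Fin n => Finset.range (b + 1)).image List.ofFn
  have hS : E.toFinset ⊆ S := by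
    intro e he
    obtain ⟨rfl, h2⟩ := h e (by simpa using he)
    refine Finset.mem_image.2 ⟨e.get, ?_, List.ofFn_get e⟩
    simp only [Fintype.mem_piFinset, Finset.mem_range]
    exact fun i => Nat.lt_succ_of_le (h2 _ (List.get_mem e i))
  calc E.length = E.toFinset.card := (List.toFinset_card_of_nodup hE).symm
    _ ≤ S.card := Finset.card_le_card hS
    _ ≤ _ := Finset.card_image_le
    _ = (b + 1) ^ n := by simp

/-! ### Enumeration of the join -/

/-- Words smaller than `B` suffice for a join with `m` tables with lengths, row numbers and entries
at most `b`. -/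
structure WordBound (m b B : ℕ) : Prop where
  arity : m + 1 ≤ b
  table : addr b b b < B
  code : ∀ l : List ℕ, l.length ≤ m + 1 → (∀ x ∈ l, x ≤ b) → addr 0 (listCode l) 0 < B
  count : (b + 1) ^ (m + 1) < B

variable {w : List ℕ} {m b B : ℕ} {s : State} {Q : State → Prop} {L : ℕ → ℕ → List ℕ} {y : ℕ}

theorem WordBound.lt (hB : WordBound m b B) : b + 1 < B :=
  (Nat.le_self_pow (by omega) _).trans_lt hB.count

theorem WordBound.addr_lt (hB : WordBound m b B) {i y k : ℕ} (hi : i ≤ b) (hy : y ≤ b)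
    (hk : k ≤ b) : addr i y k < B :=
  (addr_le_addr hi hy hk).trans_lt hB.table

theorem WordBound.pairing_lt (hB : WordBound m b B) {i y : ℕ} (hi : i ≤ b) (hy : y ≤ b) :
    pairing i y < B :=
  lt_of_le_of_lt ((Nat.le_add_right _ _).trans (add_le_pairing _ _))
    (hB.addr_lt hi hy (Nat.zero_le _))

theorem WordBound.prod_lt (hB : WordBound m b B) {k : ℕ} (hk : k ≤ m) {d : ℕ → ℕ}
    (hd : ∀ i < m, d i ≤ b) : ∏ i ∈ Finset.range k, d i < B := by
  refine lt_of_le_of_lt ?_ hB.count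
  calc ∏ i ∈ Finset.range k, d i ≤ ∏ i ∈ Finset.range k, b :=
        Finset.prod_le_prod' fun i hi => hd i (by simp at hi; omega)
    _ = b ^ k := by simp
    _ ≤ (b + 1) ^ k := Nat.pow_le_pow_left (by omega) _
    _ ≤ _ := Nat.pow_le_pow_right (by omega) (by omega)

/-- Multiply register `8` by the length of row `reg 3` of the table `k + 1`. -/
def Cmd.mulLength (k : ℕ) : Cmd :=
  .op (.const 7 (k + 1)) ;; .pair 5 7 3 ;; .pair 5 5 0 ;; .op (.load 6 5) ;; .op (.mul 8 8 6)

theorem WP.mulLengths (hB : WordBound m b B) (h0 : s.reg 0 = 0) (hy : s.reg 3 = y) (hyb : y ≤ b)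
    {S : Set ℕ} (hmem : MemOk s.mem L S) (hL : ∀ i < m, (L i y).length ≤ b) (h8 : s.reg 8 = 1) :
    WP w B (.unroll .mulLength m) s fun s' => s'.mem = s.mem ∧ s'.inp = s.inp ∧ s'.out = s.out ∧
      s'.time = s.time + 9 * m ∧ s'.reg 8 = ∏ i ∈ Finset.range m, (L i y).length ∧
      ∀ r, (r < 4 ∨ 8 < r) → s'.reg r = s.reg r := by
  refine WP.unroll (fun k s' => s'.mem = s.mem ∧ s'.inp = s.inp ∧ s'.out = s.out ∧
      s'.time = s.time + 9 * k ∧ s'.reg 8 = ∏ i ∈ Finset.range k, (L i y).length ∧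
      ∀ r, (r < 4 ∨ 8 < r) → s'.reg r = s.reg r) (by simp [h8]) ?_
  rintro k hk s' ⟨hm, hi, ho, ht, h8', hr⟩
  have h0' : s'.reg 0 = 0 := by rw [hr 0 (by omega), h0]
  have h3' : s'.reg 3 = y := by rw [hr 3 (by omega), hy]
  have hkb : k + 1 ≤ b := by have := hB.arity; omega
  have hcnt := hmem.length k y
  have hbB := hB.lt
  refine WP.seq (WP.const (by omega) ?_)
  refine WP.seq (WP.pair (by decide) ?_ ?_)
  · simpa [h3'] using hB.pairing_lt hkb hyb
  refine WP.seq (WP.pair (by decide) ?_ ?_)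
  · simpa [h3', h0', ← addr.eq_1] using hB.addr_lt hkb hyb (Nat.zero_le _)
  refine WP.seq (WP.load (WP.mul ?_ ?_))
  · simpa [h3', h0', ← addr.eq_1, hm, hcnt, h8', Finset.prod_range_succ] using
      hB.prod_lt (k := k + 1) (by omega) hL
  refine ⟨by simp [hm], by simp [hi], by simp [ho], by simp [ht]; omega, ?_, fun r h => ?_⟩
  · simp [h3', h0', ← addr.eq_1, hm, hcnt, h8', Finset.prod_range_succ]
  · have : r ≠ 4 ∧ r ≠ 5 ∧ r ≠ 6 ∧ r ≠ 7 ∧ r ≠ 8 := by omega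
    simp [this, hr r h]

/-- Split the last digit off register `9`, and load the entry with that number in row `reg 3` of
the table `k + 1` to register `16 + k`. -/
def Cmd.loadDigit (k : ℕ) : Cmd :=
  .op (.const 7 (k + 1)) ;; .pair 5 7 3 ;; .pair 4 5 0 ;; .op (.load 6 4) ;; .op (.div 12 9 6) ;;
  .op (.mul 4 12 6) ;; .op (.sub 4 9 4) ;; .op (.add 4 4 1) ;; .pair 5 5 4 ;;
  .op (.load (16 + k) 5) ;; .op (.add 9 12 0)

theorem WP.loadDigit (hB : WordBound m b B) (h0 : s.reg 0 = 0) (h1 : s.reg 1 = 1)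
    (hy : s.reg 3 = y) (hyb : y ≤ b) {k d r x : ℕ} (hk : k < m) (hr : s.reg 9 = r)
    (hcnt : s.mem (addr (k + 1) y 0) = d) (hd : r % d < d) (hdb : d ≤ b)
    (hent : s.mem (addr (k + 1) y (r % d + 1)) = x) :
    WP w B (.loadDigit k) s fun s' => s'.mem = s.mem ∧ s'.inp = s.inp ∧ s'.out = s.out ∧
      s'.time = s.time + 17 ∧ s'.reg 9 = r / d ∧ s'.reg (16 + k) = x ∧
      ∀ i, (i < 4 ∨ i = 8 ∨ i = 10 ∨ 16 ≤ i) → i ≠ 16 + k → s'.reg i = s.reg i := by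
  have hkb : k + 1 ≤ b := by have := hB.arity; omega
  have hbB := hB.lt
  refine WP.of_bound fun hbound => ?_
  have hrB : r < B := hr ▸ (hbound 9).1
  -- The machine has no remainder instruction; the digit is recovered from the quotient.
  have hmod : r - r / d * d = r % d := by
    have := Nat.div_add_mod' r d
    omega
  have h16 : ∀ {a : ℕ}, a < 16 → a ≠ 16 + k := by omega
  have h16' : ∀ {a : ℕ}, a < 16 → 16 + k ≠ a := by omega
  refine WP.seq (WP.const (by omega) ?_)
  refine WP.seq (WP.pair (by decide) ?_ ?_)
  · simpa [hy] using hB.pairing_lt hkb hyb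
  refine WP.seq (WP.pair (by decide) ?_ ?_)
  · simpa [hy, h0, ← addr.eq_1] using hB.addr_lt hkb hyb (Nat.zero_le _)
  refine WP.seq (WP.load (WP.seq (WP.div (WP.seq (WP.mul ?_ (WP.seq (WP.sub (WP.seq
    (WP.add ?_ ?_)))))))))
  · simp [hy, h0, ← addr.eq_1, hcnt, hr]
    exact (Nat.div_mul_le_self r d).trans_lt hrB
  · simp [hy, h0, h1, ← addr.eq_1, hcnt, hr, hmod]
    omega
  refine WP.seq (WP.pair (by decide) ?_ ?_)
  · simpa [hy, h0, h1, ← addr.eq_1, hcnt, hr, hmod] using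
      hB.addr_lt hkb hyb (k := r % d + 1) (by omega)
  refine WP.seq (WP.load (WP.add ?_ ?_))
  · simp [hy, h0, ← addr.eq_1, hcnt, hr, h16]
    exact (Nat.div_le_self r d).trans_lt hrB
  refine ⟨by simp, by simp, by simp, by simp, ?_, ?_, fun i hi hik => ?_⟩
  · simp [hy, h0, ← addr.eq_1, hcnt, hr, h16]
  · simp [hy, h0, h1, ← addr.eq_1, hcnt, hr, hmod, h16, h16', hent]
  · have : i ≠ 4 ∧ i ≠ 5 ∧ i ≠ 6 ∧ i ≠ 7 ∧ i ≠ 9 ∧ i ≠ 12 := by omega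
    simp [this, hik]

/-- After k rounds register 9 holds j divided by the product of the first k radices, and its
remainder modulo the next radix is digit k. Nonempty rows make every digit a valid index. -/
theorem WP.loadDigits (hB : WordBound m b B) (h0 : s.reg 0 = 0) (h1 : s.reg 1 = 1)
    (hy : s.reg 3 = y) (hyb : y ≤ b) {S : Set ℕ} (hmem : MemOk s.mem L S)
    (hL : ∀ i < m, (L i y).length ≤ b) (hL' : ∀ i < m, 0 < (L i y).length) {j : ℕ}
    (h9 : s.reg 9 = j) :
    WP w B (.unroll .loadDigit m) s fun s' => s'.mem = s.mem ∧ s'.inp = s.inp ∧ s'.out = s.out ∧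
      s'.time = s.time + 17 * m ∧
      (∀ i < m, s'.reg (16 + i) = (L i y).getD (digit (fun i => (L i y).length) j i) 0) ∧
      ∀ i, (i < 4 ∨ i = 8 ∨ i = 10 ∨ 16 + m ≤ i) → s'.reg i = s.reg i := by
  refine WP.mono (WP.unroll (fun k s' => s'.mem = s.mem ∧ s'.inp = s.inp ∧ s'.out = s.out ∧
      s'.time = s.time + 17 * k ∧
      s'.reg 9 = j / ∏ i ∈ Finset.range k, (L i y).length ∧
      (∀ i < k, s'.reg (16 + i) = (L i y).getD (digit (fun i => (L i y).length) j i) 0) ∧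
      ∀ i, (i < 4 ∨ i = 8 ∨ i = 10 ∨ 16 + k ≤ i) → s'.reg i = s.reg i) (by simp [h9]) ?_)
    fun s' ⟨hm, hi, ho, ht, _, h⟩ => ⟨hm, hi, ho, ht, h⟩
  rintro k hk s' ⟨hm, hi, ho, ht, h9', hx, hr⟩
  have hdig : s'.reg 9 % (L k y).length = digit (fun i => (L i y).length) j k := by
    rw [h9']; rfl
  have hlt := Nat.mod_lt (s'.reg 9) (hL' k hk)
  refine WP.mono (WP.loadDigit hB (by rw [hr 0 (by omega), h0]) (by rw [hr 1 (by omega), h1])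
    (by rw [hr 3 (by omega), hy]) hyb hk rfl (by rw [hm, hmem.length]) hlt (hL k hk) (by
      rw [hm, hmem.entry k y _ _ (List.getElem?_eq_getElem hlt)])) ?_
  rintro s2 ⟨hm2, hi2, ho2, ht2, h92, hx2, hr2⟩
  refine ⟨hm2.trans hm, hi2.trans hi, ho2.trans ho, by omega, ?_, fun i h => ?_, fun i h => ?_⟩
  · rw [h92, h9', Nat.div_div_eq_div_mul, Finset.prod_range_succ]
  · rcases Nat.lt_succ_iff_lt_or_eq.1 h with h | rfl
    · rw [hr2 _ (by omega) (by omega), hx i h]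
    · rw [hx2, ← hdig, List.getD_eq_getElem _ _ hlt]
  · rw [hr2 i (by omega) (by omega), hr i (by omega)]

/-- The contents of the registers `16, …, 16 + k - 1`. -/
def State.vec (s : State) (k : ℕ) : List ℕ := (List.range k).map fun i => s.reg (16 + i)

theorem State.vec_succ (s : State) (k : ℕ) : s.vec (k + 1) = s.vec k ++ [s.reg (16 + k)] := by
  simp [State.vec, List.range_succ]

theorem WP.listCode (hB : WordBound m b B) (h11 : s.reg 11 = 0)
    (hb : ∀ x ∈ s.vec (m + 1), x ≤ b) :
    WP w B (.unroll (fun k => .pair 11 11 (16 + k)) (m + 1)) s fun s' => s'.mem = s.mem ∧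
      s'.inp = s.inp ∧ s'.out = s.out ∧ s'.time = s.time + 3 * (m + 1) ∧
      s'.reg 11 = listCode (s.vec (m + 1)) ∧ ∀ r, r ≠ 4 → r ≠ 11 → s'.reg r = s.reg r := by
  refine WP.unroll (fun k s' => s'.mem = s.mem ∧
      s'.inp = s.inp ∧ s'.out = s.out ∧ s'.time = s.time + 3 * k ∧
      s'.reg 11 = CQEval.listCode (s.vec k) ∧ ∀ r, r ≠ 4 → r ≠ 11 → s'.reg r = s.reg r)
    (by simp [h11, State.vec, CQEval.listCode]) ?_
  rintro k hk s' ⟨hm, hi, ho, ht, h11', hr⟩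
  have hp : pairing (s'.reg 11) (s'.reg (16 + k)) = CQEval.listCode (s.vec (k + 1)) := by
    rw [State.vec_succ, listCode_append_singleton, h11', hr _ (by omega) (by omega)]
  refine WP.pair (by decide) ?_ ?_
  · rw [hp]
    -- The code of a prefix is itself covered by the bound for mark addresses, because an address
    -- dominates its components.
    refine lt_of_le_of_lt ?_ (hB.code (s.vec (k + 1)) (by simp [State.vec]; omega) fun x hx => ?_)
    · calc _ ≤ 0 + CQEval.listCode (s.vec (k + 1)) := by omega
        _ ≤ _ := add_le_pairing _ _
        _ ≤ _ := (Nat.le_add_right _ _).trans (add_le_pairing _ _)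
    · refine hb x ?_
      simp only [State.vec, List.mem_map, List.mem_range] at hx ⊢
      obtain ⟨i, hi, rfl⟩ := hx
      exact ⟨i, by omega, rfl⟩
  · refine ⟨by simp [hm], by simp [hi], by simp [ho], by simp [ht]; omega, by simp [hp], ?_⟩
    intro r h h'
    simp [h, h', hr]

theorem WP.writeVec {k : ℕ} :
    WP w B (.unroll (fun i => .op (.write (16 + i))) k) s fun s' => s'.mem = s.mem ∧
      s'.inp = s.inp ∧ s'.out = s.out ++ s.vec k ∧ s'.time = s.time + k ∧ s'.reg = s.reg := by
  refine WP.unroll (fun k s' => s'.mem = s.mem ∧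
      s'.inp = s.inp ∧ s'.out = s.out ++ s.vec k ∧ s'.time = s.time + k ∧ s'.reg = s.reg)
    (by simp [State.vec]) ?_
  rintro k - s' ⟨hm, hi, ho, ht, hr⟩
  refine WP.write ⟨by simp [hm], by simp [hi], ?_, by simp [ht]; omega, by funext; simp [hr]⟩
  simp [ho, hr, State.vec_succ]

/-- The lists `E`, of length `n` and with entries at most `b`, were written so far. -/
structure Emitted (n b : ℕ) (L : ℕ → ℕ → List ℕ) (E : List (List ℕ)) (s : State) : Prop where
  nodup : E.Nodup
  length : ∀ e ∈ E, e.length = n ∧ ∀ x ∈ e, x ≤ b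
  out : s.out = E.flatten
  count : s.reg 10 = E.length
  mem : MemOk s.mem L (listCode '' {e | e ∈ E})

/-- Put the address of the mark of the registers `16, …, 16 + m` to register `5`, and the mark to
register `6`. -/
def Cmd.loadMark (m : ℕ) : Cmd :=
  .op (.add 11 0 0) ;; .unroll (fun k => .pair 11 11 (16 + k)) (m + 1) ;;
  .pair 5 0 11 ;; .pair 5 5 0 ;; .op (.load 6 5)

theorem WP.loadMark (hB : WordBound m b B) (h0 : s.reg 0 = 0)
    (hb : ∀ x ∈ s.vec (m + 1), x ≤ b) :
    WP w B (.loadMark m) s fun s' => s'.mem = s.mem ∧ s'.inp = s.inp ∧ s'.out = s.out ∧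
      s'.time = s.time + (3 * m + 11) ∧ s'.reg 5 = addr 0 (CQEval.listCode (s.vec (m + 1))) 0 ∧
      s'.reg 6 = s.mem (addr 0 (CQEval.listCode (s.vec (m + 1))) 0) ∧
      ∀ i, (i < 4 ∨ i = 8 ∨ i = 10 ∨ 16 ≤ i) → s'.reg i = s.reg i := by
  have hbB := hB.lt
  have hlen : (s.vec (m + 1)).length = m + 1 := by simp [State.vec]
  have hcode := hB.code _ hlen.le hb
  refine WP.seq (WP.add (by omega) ?_)
  have hv0 : ∀ k, (s.set 11 (s.reg 0 + s.reg 0)).vec k = s.vec k := fun k => by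
    simp only [State.vec, List.map_inj_left]
    intro i _
    have : 16 + i ≠ 11 := by omega
    simp [this]
  refine WP.seq (WP.mono (WP.listCode hB (by simp [h0]) (by rwa [hv0])) ?_)
  rw [hv0]
  rintro s1 ⟨hm, hi, ho, ht, h11, hr⟩
  have h0' : s1.reg 0 = 0 := by rw [hr 0 (by omega) (by omega)]; simp [h0]
  refine WP.seq (WP.pair (by decide) ?_ ?_)
  · rw [h0', h11]
    exact lt_of_le_of_lt ((Nat.le_add_right _ _).trans (add_le_pairing _ _)) hcode
  refine WP.seq (WP.pair (by decide) ?_ (WP.load ?_))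
  · simpa [h0', h11, ← addr.eq_1] using hcode
  refine ⟨by simp [hm], by simp [hi], by simp [ho], by simp [ht]; omega, ?_, ?_, fun i h => ?_⟩
  · simp [h0', h11, ← addr.eq_1]
  · simp [h0', h11, ← addr.eq_1, hm]
  · have : i ≠ 4 ∧ i ≠ 5 ∧ i ≠ 6 ∧ i ≠ 11 := by omega
    simp [this, hr]

/-- Write the registers `16, …, 16 + m` unless this was done before, and count. -/
def Cmd.emit (m : ℕ) : Cmd :=
  .loadMark m ;;
  .unlessLt 0 6 (.op (.store 5 1) ;; .unroll (fun i => .op (.write (16 + i))) (m + 1) ;;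
    .op (.add 10 10 1))

/-- All candidates have length m + 1, where `listCode` is injective, so the mark is set exactly if
the candidate was written before. -/
theorem WP.emit (hB : WordBound m b B) (h0 : s.reg 0 = 0) (h1 : s.reg 1 = 1)
    (hb : ∀ x ∈ s.vec (m + 1), x ≤ b) {E : List (List ℕ)} (hE : Emitted (m + 1) b L E s) :
    WP w B (.emit m) s fun s' => s'.inp = s.inp ∧ s'.time ≤ s.time + (4 * m + 15) ∧
      (∀ i, (i < 4 ∨ i = 8 ∨ 16 ≤ i) → s'.reg i = s.reg i) ∧
      ∃ E', Emitted (m + 1) b L E' s' ∧ ∀ e, e ∈ E' ↔ e ∈ E ∨ e = s.vec (m + 1) := by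
  have hlen : (s.vec (m + 1)).length = m + 1 := by simp [State.vec]
  have hseen := hE.mem.seen (CQEval.listCode (s.vec (m + 1)))
  refine WP.seq (WP.mono (WP.loadMark hB h0 hb) ?_)
  rintro s1 ⟨hm, hi, ho, ht, h5, h6, hr⟩
  refine WP.unlessLt (fun h => ?_) fun h => ?_
  · rw [h6, hr 0 (by omega), h0, hseen] at h
    refine ⟨hi, by simp [ht]; omega, fun i h => hr i (by omega), E, ?_, ?_⟩
    · exact ⟨hE.nodup, hE.length, ho.trans hE.out, (hr 10 (by omega)).trans hE.count,
        by simpa [hm] using hE.mem⟩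
    · obtain ⟨e, he, hec⟩ := h
      rw [listCode_inj ((hE.length e he).1.trans hlen.symm)] at hec
      subst hec
      intro e
      exact ⟨Or.inl, fun h => h.elim id fun h => h ▸ he⟩
  · rw [h6, hr 0 (by omega), h0, ← not_lt, hseen] at h
    have hnew : s.vec (m + 1) ∉ E := fun hmem => h ⟨_, hmem, rfl⟩
    have hnodup : (E ++ [s.vec (m + 1)]).Nodup := by
      rw [List.nodup_append]
      refine ⟨hE.nodup, List.nodup_singleton _, ?_⟩
      rintro e he e' he' rfl
      exact hnew (List.mem_singleton.1 he' ▸ he)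
    have hlength : ∀ e ∈ E ++ [s.vec (m + 1)], e.length = m + 1 ∧ ∀ x ∈ e, x ≤ b := by
      intro e he
      rcases List.mem_append.1 he with he | he
      · exact hE.length e he
      · rw [List.mem_singleton.1 he]
        exact ⟨hlen, hb⟩
    -- Distinct bounded answers are few enough for the incremented counter to fit in a word.
    have hcount := (length_le_of_nodup hnodup hlength).trans_lt hB.count
    simp only [List.length_append, List.length_singleton] at hcount
    refine WP.seq (WP.store (WP.seq (WP.mono WP.writeVec ?_)))
    rintro s2 ⟨hm2, hi2, ho2, ht2, hr2⟩
    have hfr : ∀ i, (i < 4 ∨ i = 8 ∨ i = 10 ∨ 16 ≤ i) → s2.reg i = s.reg i := fun i h => by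
      rw [hr2]
      exact hr i h
    refine WP.add ?_ ?_
    · rw [hfr 10 (by omega), hfr 1 (by omega), hE.count, h1]
      exact hcount
    · refine ⟨by simp [hi2, hi], by simp [ht2, ht]; omega, fun i h => ?_,
        E ++ [s.vec (m + 1)], ⟨hnodup, hlength, ?_, ?_, ?_⟩, by simp⟩
      · rw [← hfr i (by omega)]
        simp [show i ≠ 10 by omega]
      · simp only [State.set_out, ho2, List.flatten_append, ← hE.out]
        simp only [State.setMem_out, State.wait_out, ho]
        congr 1
        simp only [List.flatten_singleton, State.vec, List.map_inj_left]
        exact fun i _ => hr _ (by omega)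
      · simp [hfr 10, hfr 1, hE.count, h1]
      · have := hE.mem.mark (CQEval.listCode (s.vec (m + 1)))
        have hset : CQEval.listCode '' {e | e ∈ E ++ [s.vec (m + 1)]} =
            insert (CQEval.listCode (s.vec (m + 1))) (CQEval.listCode '' {e | e ∈ E}) := by
          rw [← Set.image_insert_eq]
          congr 1
          ext e
          simp [or_comm]
        rw [hset]
        convert this using 1
        simp [hm2, hm, h5, hr 1, h1]

end CQEval

namespace CQEval

/-! ### The join loops and the complete program -/

variable {w : List ℕ} {m b B : ℕ} {s : State} {L : ℕ → ℕ → List ℕ} {x y : ℕ}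

theorem Emitted.congr {n : ℕ} {E : List (List ℕ)} {s s' : State} (h : Emitted n b L E s)
    (ho : s'.out = s.out) (hr : s'.reg 10 = s.reg 10) (hm : s'.mem = s.mem) :
    Emitted n b L E s' :=
  ⟨h.nodup, h.length, ho.trans h.out, hr.trans h.count, hm ▸ h.mem⟩

/-- `e` consists of elements of the rows `L 0 y, …, L (m - 1) y` and of `x`. -/
def Joins (L : ℕ → ℕ → List ℕ) (m x y : ℕ) (e : List ℕ) : Prop :=
  ∃ f : ℕ → ℕ, (∀ k < m, f k ∈ L k y) ∧ f m = x ∧ e = (List.range (m + 1)).map f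

/-- The combination number `j` of the elements of the rows `L 0 y, …, L (m - 1) y` and of `x`. -/
def combination (L : ℕ → ℕ → List ℕ) (m x y j : ℕ) : List ℕ :=
  (List.range (m + 1)).map fun k =>
    if k < m then (L k y).getD (digit (fun i => (L i y).length) j k) 0 else x

/-- A choice of positions in the rows is a string of digits. Conversely, a j below the product
forces all rows to be nonempty, so the digits are valid positions and the default 0 is never used.
-/
theorem joins_iff {e : List ℕ} : Joins L m x y e ↔
    ∃ j < ∏ i ∈ Finset.range m, (L i y).length, e = combination L m x y j := by
  constructor
  · rintro ⟨f, hf, rfl, rfl⟩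
    have : ∀ k, ∃ a, k < m → ∃ h : a < (L k y).length, (L k y)[a] = f k := fun k => by
      by_cases hk : k < m
      · obtain ⟨a, h, h'⟩ := List.getElem_of_mem (hf k hk)
        exact ⟨a, fun _ => ⟨h, h'⟩⟩
      · exact ⟨0, fun h => absurd h hk⟩
    choose a ha using this
    obtain ⟨j, hj, hd⟩ := exists_digit_eq (fun i => (L i y).length) a m fun k hk => (ha k hk).1
    refine ⟨j, hj, ?_⟩
    simp only [combination, List.map_inj_left, List.mem_range]
    intro k hk
    rcases Nat.lt_succ_iff_lt_or_eq.1 hk with hk | rfl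
    · obtain ⟨h, h'⟩ := ha k hk
      rw [if_pos hk, hd k hk, List.getD_eq_getElem _ _ h, h']
    · simp
  · rintro ⟨j, hj, rfl⟩
    refine ⟨_, fun k hk => ?_, ?_, rfl⟩
    · have hpos : 0 < (L k y).length := by
        by_contra h0
        have : ∏ i ∈ Finset.range m, (L i y).length = 0 :=
          Finset.prod_eq_zero (Finset.mem_range.2 hk) (by omega)
        omega
      have hlt : digit (fun i => (L i y).length) j k < (L k y).length := Nat.mod_lt _ hpos
      rw [if_pos hk, List.getD_eq_getElem _ _ hlt]
      exact List.getElem_mem hlt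
    · simp

/-- Write the combinations of the elements of row `reg 3` of the tables `1, …, m` with register
`16 + m`, unless they were written before. -/
def Cmd.joinRow (m : ℕ) : Cmd :=
  .op (.const 8 1) ;; .unroll .mulLength m ;;
  .whileLt 0 8 (.op (.sub 8 8 1) ;; .op (.add 9 8 0) ;; .unroll .loadDigit m ;; .emit m)

theorem WP.joinRow (hB : WordBound m b B) (h0 : s.reg 0 = 0) (h1 : s.reg 1 = 1)
    (hy : s.reg 3 = y) (hyb : y ≤ b) (hx : s.reg (16 + m) = x) (hxb : x ≤ b)
    (hL : ∀ i < m, (L i y).length ≤ b) (hLb : ∀ i < m, ∀ z ∈ L i y, z ≤ b)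
    {E : List (List ℕ)} (hE : Emitted (m + 1) b L E s) :
    WP w B (.joinRow m) s fun s' => s'.inp = s.inp ∧
      s'.time ≤ s.time + (9 * m + 3 + (21 * m + 19) * ∏ i ∈ Finset.range m, (L i y).length) ∧
      (∀ i < 4, s'.reg i = s.reg i) ∧
      ∃ E', Emitted (m + 1) b L E' s' ∧ ∀ e, e ∈ E' ↔ e ∈ E ∨ Joins L m x y e := by
  have hbB := hB.lt
  have hfr0 : ∀ i, i ≠ 8 → (s.set 8 1).reg i = s.reg i := fun i hi => by simp [hi]
  refine WP.seq (WP.const (by omega) (WP.seq (WP.mono (WP.mulLengths (y := y) hB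
    (by simp [h0]) (by simp [hy]) hyb (by simpa using hE.mem) hL (by simp)) ?_)))
  set T := ∏ i ∈ Finset.range m, (L i y).length with hT
  rintro s1 ⟨hm1, hi1, ho1, ht1, h8, hr1⟩
  -- The counter runs downwards: with k rounds left, exactly the combinations k, …, T - 1 have been
  -- treated. Storing the remaining cost on the left of the time bound avoids a subtraction.
  refine WP.whileLt (n := T) (fun k s' => k ≤ T ∧ s'.reg 8 = k ∧ s'.inp = s.inp ∧
    (∀ i < 4, s'.reg i = s.reg i) ∧ s'.reg (16 + m) = x ∧
    s'.time + (21 * m + 19) * k ≤ s.time + (9 * m + 1) + (21 * m + 19) * T ∧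
    ∃ E', Emitted (m + 1) b L E' s' ∧
      ∀ e, e ∈ E' ↔ e ∈ E ∨ ∃ j, k ≤ j ∧ j < T ∧ e = combination L m x y j) ?_ ?_ ?_
  · refine ⟨le_rfl, h8, by simp [hi1], fun i hi => ?_, ?_, ?_, E, ?_, fun e => ?_⟩
    · rw [hr1 i (by omega), hfr0 i (by omega)]
    · rw [hr1 _ (by omega), hfr0 _ (by omega), hx]
    · simp [ht1]; omega
    · refine hE.congr (by simp [ho1]) ?_ (by simp [hm1])
      rw [hr1 _ (by omega), hfr0 _ (by omega)]
    · constructor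
      · exact Or.inl
      · rintro (h | ⟨j, hj, hj', -⟩)
        · exact h
        · omega
  · rintro k s2 ⟨hkT, h8', hi2, hr2, hx2, ht2, E2, hE2, hmem2⟩
    have h02 : s2.reg 0 = 0 := by rw [hr2 0 (by omega), h0]
    have h12 : s2.reg 1 = 1 := by rw [hr2 1 (by omega), h1]
    refine ⟨by omega, ?_⟩
    -- A round takes place, so the product T is positive and no row is empty.
    have hpos : ∀ i < m, 0 < (L i y).length := by
      intro i hi
      by_contra hi0
      have : T = 0 := Finset.prod_eq_zero (Finset.mem_range.2 hi) (by omega)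
      omega
    have hTB : T < B := hB.prod_lt le_rfl hL
    refine WP.seq (WP.sub (WP.seq (WP.add ?_ ?_)))
    · simp [h02, h8', h12]; omega
    refine WP.seq (WP.mono (WP.loadDigits (y := y) (j := k) hB (by simp [h02]) (by simp [h12])
      (by simp [hr2 3, hy]) hyb (by simpa using hE2.mem) hL hpos (by simp [h8', h12, h02])) ?_)
    rintro s3 ⟨hm3, hi3, ho3, ht3, hx3, hr3⟩
    have hfr3 : ∀ i, (i < 4 ∨ i = 10 ∨ 16 + m ≤ i) → s3.reg i = s2.reg i := fun i hi => by
      have : i ≠ 8 ∧ i ≠ 9 := by omega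
      rw [hr3 i (by omega)]
      simp [this]
    have hv : s3.vec (m + 1) = combination L m x y k := by
      simp only [State.vec, combination, List.map_inj_left, List.mem_range]
      intro i hi
      rcases Nat.lt_succ_iff_lt_or_eq.1 hi with hi | rfl
      · rw [if_pos hi, hx3 i hi]
      · rw [if_neg (by omega), hfr3 _ (by omega), hx2]
    refine WP.mono (WP.emit hB (E := E2) (by rw [hfr3 0 (by omega), h02])
      (by rw [hfr3 1 (by omega), h12]) ?_ (hE2.congr (by simp [ho3]) (hfr3 10 (by omega))
        (by simp [hm3]))) ?_
    · rw [hv]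
      obtain ⟨f, hf, hfx, hfe⟩ : Joins L m x y _ := joins_iff.2 ⟨k, by omega, rfl⟩
      rw [hfe]
      simp only [List.mem_map, List.mem_range, forall_exists_index, and_imp]
      rintro z i hi rfl
      rcases Nat.lt_succ_iff_lt_or_eq.1 hi with hi | rfl
      · exact hLb i hi _ (hf i hi)
      · omega
    · rw [hv]
      rintro s4 ⟨hi4, ht4, hr4, E4, hE4, hmem4⟩
      refine ⟨by omega, ?_, by simp [hi4, hi3, hi2], fun i hi => ?_, ?_, ?_, E4,
        hE4.congr rfl rfl rfl, fun e => ?_⟩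
      · simp [hr4 8, hr3 8, h8', h12]
      · simp [hr4 i (by omega), hfr3 i (by omega), hr2 i hi]
      · simp [hr4 (16 + m) (by omega), hfr3 (16 + m) (by omega), hx2]
      · simp only [State.wait_time, State.set_time] at ht3 ⊢
        rw [Nat.mul_add] at ht2
        omega
      · rw [hmem4, hmem2]
        constructor
        · rintro ((h | ⟨j, hj, h⟩) | rfl)
          · exact Or.inl h
          · exact Or.inr ⟨j, by omega, h⟩
          · exact Or.inr ⟨k, le_rfl, by omega, rfl⟩
        · rintro (h | ⟨j, hj, h, rfl⟩)
          · exact Or.inl (Or.inl h)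
          · rcases hj.eq_or_lt with rfl | hj
            · exact Or.inr rfl
            · exact Or.inl (Or.inr ⟨j, hj, h, rfl⟩)
  · rintro s2 ⟨-, h8', hi2, hr2, hx2, ht2, E2, hE2, hmem2⟩
    refine ⟨by omega, hi2, by simp; omega, hr2, E2, hE2.congr rfl rfl rfl, fun e => ?_⟩
    rw [hmem2, joins_iff]
    simp [hT]

/-- Read the last relation and join each of its tuples with the tables. -/
def Cmd.joinRelation (m : ℕ) : Cmd :=
  .op (.read 2) ;;
  .whileLt 0 2 (.op (.read (16 + m)) ;; .op (.read 3) ;; .joinRow m ;; .op (.sub 2 2 1))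

/-- The last relation is only streamed. Its x-values take the place of the m-th fibre, so summing
over its tuples supplies the missing factor of the product. -/
theorem WP.joinRelation (hB : WordBound m b B) (h0 : s.reg 0 = 0) (h1 : s.reg 1 = 1)
    {l : List (ℕ × ℕ)} (hl : l.length ≤ b) (hlb : ∀ t ∈ l, t.1 ≤ b ∧ t.2 ≤ b)
    (hinp : s.inp = l.length :: pairsInput l)
    (hL : ∀ y, ∀ i < m, (L i y).length ≤ b) (hLb : ∀ y, ∀ i < m, ∀ z ∈ L i y, z ≤ b)
    (hE : Emitted (m + 1) b L [] s) :
    WP w B (.joinRelation m) s fun s' => s'.time ≤ s.time + 3 + (l.map fun t =>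
        9 * m + 8 + (21 * m + 19) * ∏ i ∈ Finset.range m, (L i t.2).length).sum ∧
      ∃ E, Emitted (m + 1) b L E s' ∧ ∀ e, e ∈ E ↔ ∃ t ∈ l, Joins L m t.1 t.2 e := by
  have hbB := hB.lt
  refine WP.seq (WP.read hinp (by omega) ?_)
  refine WP.whileLt (n := l.length) (fun k s' => ∃ pre suf, l = pre ++ suf ∧ suf.length = k ∧
    s'.inp = pairsInput suf ∧ s'.reg 2 = k ∧ s'.reg 0 = 0 ∧ s'.reg 1 = 1 ∧
    s'.time ≤ s.time + 1 + (pre.map fun t =>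
      9 * m + 8 + (21 * m + 19) * ∏ i ∈ Finset.range m, (L i t.2).length).sum ∧
    ∃ E, Emitted (m + 1) b L E s' ∧ ∀ e, e ∈ E ↔ ∃ t ∈ pre, Joins L m t.1 t.2 e) ?_ ?_ ?_
  · exact ⟨[], l, by simp, rfl, rfl, by simp, by simp [h0], by simp [h1], by simp, [],
      hE.congr (by simp) (by simp) (by simp), by simp⟩
  · rintro k s1 ⟨pre, suf, rfl, hk, hi1, h2, h01, h11, ht1, E, hE1, hmem1⟩
    refine ⟨by omega, ?_⟩
    obtain _ | ⟨⟨x, y⟩, suf⟩ := suf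
    · simp at hk
    have hxy := hlb (x, y) (by simp)
    simp only at hxy
    have h16 : ∀ {a : ℕ}, a < 16 → a ≠ 16 + m := by omega
    have h16' : ∀ {a : ℕ}, a < 16 → 16 + m ≠ a := by omega
    refine WP.seq (WP.read (x := x) (l := y :: pairsInput suf) (by simp [hi1, pairsInput])
      (by omega) ?_)
    refine WP.seq (WP.read rfl (by omega) ?_)
    refine WP.seq (WP.mono (WP.joinRow (x := x) (y := y) hB (by simp [h01, h16])
      (by simp [h11, h16]) (by simp) hxy.2 (by simp [h16']) hxy.1 (hL y) (hLb y)
      (hE1.congr (by simp) (by simp [h16]) (by simp))) ?_)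
    rintro s2 ⟨hi2, ht2, hr2, E', hE', hmem'⟩
    refine WP.sub ?_
    refine ⟨pre ++ [(x, y)], suf, by simp, by simpa using hk, by simp [hi2], ?_, ?_, ?_, ?_, E',
      hE'.congr (by simp) (by simp) (by simp), fun e => ?_⟩
    · simp [hr2, h2, h16, h11]
    · simp [hr2, h01, h16]
    · simp [hr2, h11, h16]
    · simp only [State.wait_time, State.set_time, State.input_time, List.map_append, List.map_cons,
        List.map_nil, List.sum_append, List.sum_singleton] at ht2 ⊢
      omega
    · rw [hmem', hmem1]
      simp [or_and_right, exists_or]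
  · rintro s1 ⟨pre, suf, rfl, hk, hi1, h2, h01, h11, ht1, E, hE1, hmem1⟩
    obtain rfl : suf = [] := List.length_eq_zero_iff.1 hk
    refine ⟨by omega, ?_, E, hE1.congr rfl rfl rfl, by simpa using hmem1⟩
    simp only [State.wait_time, List.append_nil]
    omega

/-- The program for the star query with `m + 1` atoms. -/
def Cmd.starJoin (m : ℕ) : Cmd :=
  .op (.const 1 1) ;; .unroll .readTable m ;; .joinRelation m ;; .op (.write 10)

theorem WP.starJoin (hB : WordBound m b B) (rel : ℕ → List (ℕ × ℕ))
    (hlen : ∀ i ≤ m, (rel i).length ≤ b) (hrel : ∀ i ≤ m, ∀ t ∈ rel i, t.1 ≤ b ∧ t.2 ≤ b) :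
    WP w B (.starJoin m) ⟨fun _ => 0, fun _ => 0, (List.range (m + 1)).flatMap fun i =>
        (rel i).length :: pairsInput (rel i), [], 0⟩ fun s' =>
      s'.time ≤ 5 + ∑ i ∈ Finset.range m, (3 + 19 * (rel i).length) + ((rel m).map fun t =>
        9 * m + 8 + (21 * m + 19) *
          ∏ i ∈ Finset.range m, (fiber (rel i) t.2).length).sum ∧
      ∃ E : List (List ℕ), E.Nodup ∧ s'.out = E.flatten ++ [E.length] ∧
        ∀ e, e ∈ E ↔ ∃ y f, (∀ k ≤ m, (f k, y) ∈ rel k) ∧ e = (List.range (m + 1)).map f := by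
  have hbB := hB.lt
  have harity := hB.arity
  refine WP.seq (WP.const (by omega) (WP.seq (WP.mono (WP.unroll (fun k s' =>
    s'.inp = ((List.range' k (m + 1 - k)).flatMap fun i =>
      (rel i).length :: pairsInput (rel i)) ∧
    s'.out = [] ∧ s'.reg 0 = 0 ∧ s'.reg 1 = 1 ∧ s'.reg 10 = 0 ∧
    s'.time = 1 + ∑ i ∈ Finset.range k, (3 + 19 * (rel i).length) ∧
    -- Tables not yet read are still empty, as `WP.readTable` requires.
    MemOk s'.mem (fun i => if i < k then fiber (rel i) else fun _ => []) ∅) ?_ ?_) ?_)))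
  · refine ⟨by simp [List.range_eq_range'], rfl, by simp, by simp, by simp, by simp, ?_⟩
    simpa using memOk_zero
  · rintro k hk s1 ⟨hi, ho, h0, h1, h10, ht, hm⟩
    have hrange : List.range' k (m + 1 - k) = k :: List.range' (k + 1) (m + 1 - (k + 1)) := by
      rw [show m + 1 - k = m + 1 - (k + 1) + 1 by omega, List.range'_succ]
    rw [hrange, List.flatMap_cons, List.cons_append] at hi
    refine WP.mono (WP.readTable hB.table (by omega) (hlen k hk.le) (hrel k hk.le) hi h0 h1 hm
      (by simp)) ?_
    rintro s2 ⟨hi2, ho2, h02, h12, h102, ht2, hm2⟩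
    refine ⟨hi2, ho2.trans ho, h02, h12, h102.trans h10, ?_, ?_⟩
    · rw [Finset.sum_range_succ]
      omega
    · convert hm2 using 1
      funext i
      rcases lt_trichotomy i k with h | rfl | h
      · simp [h, h.ne, Nat.lt_succ_of_lt h]
      · simp
      · simp [h.ne', show ¬ i < k + 1 by omega, show ¬ i < k by omega]
  · rintro s1 ⟨hi, ho, h0, h1, h10, ht, hm⟩
    set L : ℕ → ℕ → List ℕ := fun i => if i < m then fiber (rel i) else fun _ => [] with hLdef
    have hL : ∀ i < m, L i = fiber (rel i) := fun i hi => by simp [hLdef, hi]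
    refine WP.seq (WP.mono (WP.joinRelation (l := rel m) hB h0 h1 (hlen m le_rfl)
      (hrel m le_rfl) (by simpa using hi) ?_ ?_ ⟨List.nodup_nil, by simp, by simp [ho],
        by simp [h10], by simpa using hm⟩) ?_)
    · intro y i hi
      rw [hL i hi]
      exact (length_fiber_le _ _).trans (hlen i hi.le)
    · intro y i hi z hz
      rw [hL i hi, mem_fiber] at hz
      exact (hrel i hi.le _ hz).1
    · rintro s2 ⟨ht2, E, hE, hmem⟩
      refine WP.write ⟨?_, E, hE.nodup, by simp [hE.out, hE.count], fun e => ?_⟩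
      · have : ((rel m).map fun t =>
            9 * m + 8 + (21 * m + 19) * ∏ i ∈ Finset.range m, (L i t.2).length) =
            (rel m).map fun t => 9 * m + 8 + (21 * m + 19) *
              ∏ i ∈ Finset.range m, (fiber (rel i) t.2).length := by
          refine List.map_congr_left fun t _ => ?_
          congr 2
          exact Finset.prod_congr rfl fun i hi => by rw [hL i (Finset.mem_range.1 hi)]
        rw [this] at ht2
        simp only [State.output_time]
        omega
      · rw [hmem]
        constructor
        · rintro ⟨⟨x, y⟩, ht, f, hf, rfl, he⟩
          refine ⟨y, f, fun k hk => ?_, he⟩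
          rcases hk.lt_or_eq with hk | rfl
          · have := hf k hk
            rwa [hL k hk, mem_fiber] at this
          · exact ht
        · rintro ⟨y, f, hf, he⟩
          refine ⟨(f m, y), hf m le_rfl, f, fun k hk => ?_, rfl, he⟩
          rw [hL k hk, mem_fiber]
          exact hf k hk.le

end CQEval

namespace CQEval

/-! ### Word length -/

/-- At the upper bounds the pair is 5·c^(2p) at most after absorbing the linear term, and 5 ≤ 2³ ≤
c³. -/
theorem pairing_le_pow {c p x y : ℕ} (hc : 2 ≤ c) (hx : x ≤ c ^ p) (hy : y ≤ c ^ p) :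
    pairing x y ≤ c ^ (2 * p + 3) := by
  have h1 : 1 ≤ c ^ p := Nat.one_le_pow _ _ (by omega)
  have h2 : 2 ^ 3 ≤ c ^ 3 := Nat.pow_le_pow_left hc 3
  calc pairing x y ≤ pairing (c ^ p) (c ^ p) := pairing_le_pairing hx hy
    _ ≤ 2 ^ 3 * (c ^ p * c ^ p) := by unfold pairing; nlinarith
    _ ≤ c ^ 3 * (c ^ p * c ^ p) := Nat.mul_le_mul_right _ h2
    _ = c ^ (2 * p + 3) := by ring

/-- Each further element turns an exponent q into 2q + 3. The length is bounded, so the final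
exponent does not depend on c. -/
theorem exists_listCode_le_pow (p n : ℕ) : ∃ q, p ≤ q ∧ ∀ c, 2 ≤ c → ∀ l : List ℕ, l.length ≤ n →
    (∀ x ∈ l, x ≤ c ^ p) → listCode l ≤ c ^ q := by
  induction n with
  | zero =>
    refine ⟨p, le_rfl, fun c _ l hl _ => ?_⟩
    obtain rfl := List.length_eq_zero_iff.1 (Nat.le_zero.1 hl)
    exact Nat.zero_le _
  | succ n ih =>
    obtain ⟨q, hpq, hq⟩ := ih
    refine ⟨2 * q + 3, by omega, fun c hc l hl hx => ?_⟩
    rcases List.eq_nil_or_concat l with rfl | ⟨l, x, rfl⟩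
    · exact Nat.zero_le _
    · rw [List.concat_eq_append] at hl hx ⊢
      rw [listCode_append_singleton]
      refine pairing_le_pow hc (hq c hc l (by simpa using hl) fun z hz => hx z (by simp [hz]))
        ((hx x (by simp)).trans (Nat.pow_le_pow_right (by omega) hpq))

theorem exists_wordBound (m : ℕ) : ∃ κ, ∀ N, WordBound m (N + m + 1) ((N + 2) ^ κ) := by
  obtain ⟨q, hq, hcode⟩ := exists_listCode_le_pow (m + 1) (m + 1)
  -- An address is two nested pairings, hence two applications of `pairing_le_pow`.
  set r := 2 * (2 * q + 3) + 3 with hr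
  have hb : ∀ N, N + m + 1 ≤ (N + 2) ^ (m + 1) := fun N => by
    -- The base is at least 2, even for N = 0, so constants depending on m are absorbed into the
    -- exponent.
    have h1 : m + 1 ≤ (N + 2) ^ m :=
      (Nat.lt_two_pow_self (n := m)).trans_le (Nat.pow_le_pow_left (by omega) m)
    rw [pow_succ]
    nlinarith
  have hpow : ∀ N {i j : ℕ}, i ≤ j → (N + 2) ^ i ≤ (N + 2) ^ j := fun N i j h =>
    Nat.pow_le_pow_right (by omega) h
  have haddr : ∀ N i y k, i ≤ (N + 2) ^ q → y ≤ (N + 2) ^ q → k ≤ (N + 2) ^ q →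
      addr i y k ≤ (N + 2) ^ r := fun N i y k hi hy hk =>
    pairing_le_pow (by omega) (pairing_le_pow (by omega) hi hy) (hk.trans (hpow N (by omega)))
  refine ⟨r + (m + 2) * (m + 1) + 1, fun N => ⟨by omega, ?_, fun l hl hx => ?_, ?_⟩⟩
  · have := (hb N).trans (hpow N hq)
    exact (haddr N _ _ _ this this this).trans_lt (Nat.pow_lt_pow_right (by omega) (by omega))
  · refine (haddr N _ _ _ (Nat.zero_le _) (hcode (N + 2) (by omega) l hl fun x h =>
      (hx x h).trans (hb N)) (Nat.zero_le _)).trans_lt (Nat.pow_lt_pow_right (by omega) (by omega))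
  · have h1 : N + m + 1 + 1 ≤ (N + 2) ^ (m + 2) := by
      have h2 := hb N
      have h3 : 1 ≤ (N + 2) ^ (m + 1) := Nat.one_le_pow _ _ (by omega)
      rw [pow_succ]
      nlinarith
    calc (N + m + 1 + 1) ^ (m + 1) ≤ ((N + 2) ^ (m + 2)) ^ (m + 1) := Nat.pow_le_pow_left h1 _
      _ = (N + 2) ^ ((m + 2) * (m + 1)) := by rw [← pow_mul]
      _ < _ := Nat.pow_lt_pow_right (by omega) (by omega)

/-! ### The size of the join -/

/-- Grouping by the second component: each y contributes once per element of its fibre. -/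
theorem sum_map_snd_eq (F : ℕ → ℕ) (Y : Finset ℕ) (l : List (ℕ × ℕ)) (hY : ∀ t ∈ l, t.2 ∈ Y) :
    (l.map fun t => F t.2).sum = ∑ y ∈ Y, (fiber l y).length * F y := by
  induction l with
  | nil => simp [fiber]
  | cons t l ih =>
    have h : ∀ y, (fiber (t :: l) y).length = (if t.2 = y then 1 else 0) + (fiber l y).length := by
      intro y
      by_cases hy : t.2 = y <;> simp [fiber, hy, Nat.add_comm]
    simp [h, ih fun t' ht' => hY t' (by simp [ht']), Nat.add_mul, Finset.sum_add_distrib,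
      hY t (by simp)]

/-- Split p into p^(1/n) · p^(1-1/n) and bound the factors by q and by the power of `out`. The case
p = 0 is separate since the splitting needs a positive base. -/
theorem le_mul_rpow_of_le_pow {n p q out : ℕ} (hn : n ≠ 0) (h : p ≤ q ^ n) (h' : p ≤ out) :
    (p : ℝ) ≤ q * (out : ℝ) ^ (1 - 1 / (n : ℝ)) := by
  rcases Nat.eq_zero_or_pos p with rfl | hp
  · rw [Nat.cast_zero]
    positivity
  have hp' : (0 : ℝ) < p := by exact_mod_cast hp
  have hn' : (1 : ℝ) ≤ n := by exact_mod_cast Nat.one_le_iff_ne_zero.2 hn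
  have h1 : (1 : ℝ) / n ≤ 1 := by rw [div_le_one (by linarith)]; exact hn'
  calc (p : ℝ) = (p : ℝ) ^ (1 / (n : ℝ)) * (p : ℝ) ^ (1 - 1 / (n : ℝ)) := by
        rw [← Real.rpow_add hp']; simp
    _ ≤ ((q : ℝ) ^ n) ^ (1 / (n : ℝ)) * (out : ℝ) ^ (1 - 1 / (n : ℝ)) := by
        gcongr
        exact_mod_cast h
    _ = _ := by rw [one_div, Real.pow_rpow_inv_natCast (Nat.cast_nonneg q) hn]

/-- Grouped by y, the left side is a sum of full fibre products. Each is at most the sum of its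
fibre sizes times the power of `out`, and those sums add up to the database size. -/
theorem sum_join_le {m : ℕ} {rel : ℕ → List (ℕ × ℕ)} {out : ℕ}
    (h : ∀ y, ∏ i ∈ Finset.range (m + 1), (fiber (rel i) y).length ≤ out) :
    (((rel m).map fun t => ∏ i ∈ Finset.range m, (fiber (rel i) t.2).length).sum : ℝ) ≤
      ((∑ i ∈ Finset.range (m + 1), (rel i).length : ℕ) : ℝ) *
        (out : ℝ) ^ (1 - 1 / ((m + 1 : ℕ) : ℝ)) := by
  set Y : Finset ℕ := (Finset.range (m + 1)).biUnion fun i => ((rel i).map Prod.snd).toFinset with hY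
  have hYmem : ∀ i ≤ m, ∀ t ∈ rel i, t.2 ∈ Y := fun i hi t ht => by
    simp only [hY, Finset.mem_biUnion, Finset.mem_range, List.mem_toFinset, List.mem_map]
    exact ⟨i, by omega, t, ht, rfl⟩
  have hsize : ∑ i ∈ Finset.range (m + 1), (rel i).length =
      ∑ y ∈ Y, ∑ i ∈ Finset.range (m + 1), (fiber (rel i) y).length := by
    rw [Finset.sum_comm]
    refine Finset.sum_congr rfl fun i hi => ?_
    simpa using sum_map_snd_eq (fun _ => 1) Y (rel i) (hYmem i (by simp at hi; omega))
  rw [sum_map_snd_eq (fun y => ∏ i ∈ Finset.range m, (fiber (rel i) y).length) Y _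
    (hYmem m le_rfl), hsize, Nat.cast_sum, Nat.cast_sum, Finset.sum_mul]
  refine Finset.sum_le_sum fun y _ => ?_
  rw [Nat.mul_comm, ← Finset.prod_range_succ (fun i => (fiber (rel i) y).length)]
  refine le_mul_rpow_of_le_pow (by omega) ?_ (h y)
  calc ∏ i ∈ Finset.range (m + 1), (fiber (rel i) y).length
      ≤ ∏ _i ∈ Finset.range (m + 1), ∑ j ∈ Finset.range (m + 1), (fiber (rel j) y).length :=
        Finset.prod_le_prod' fun i hi =>
          Finset.single_le_sum (f := fun j => (fiber (rel j) y).length) (by simp) hi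
    _ = _ := by simp

theorem ofFn_eq_map_range {α : Type*} (f : ℕ → α) (n : ℕ) :
    (List.ofFn fun i : Fin n => f i) = (List.range n).map f :=
  List.ext_getElem (by simp) fun i h1 h2 => by rw [List.getElem_ofFn]; simp

/-- For fixed y every choice of one element from each fibre is an answer, and different choices are
different answers. -/
theorem prod_length_fiber_le {m : ℕ} {rel : ℕ → List (ℕ × ℕ)} (hrel : ∀ i ≤ m, (rel i).Nodup)
    {E : List (List ℕ)}
    (hE : ∀ e, e ∈ E ↔ ∃ y f, (∀ k ≤ m, (f k, y) ∈ rel k) ∧ e = (List.range (m + 1)).map f)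
    (y : ℕ) : ∏ i ∈ Finset.range (m + 1), (fiber (rel i) y).length ≤ E.length := by
  have hnodup : ∀ i ≤ m, (fiber (rel i) y).Nodup := fun i hi => by
    refine List.Nodup.map_on ?_ ((hrel i hi).filter _)
    rintro ⟨a, b⟩ h ⟨a', b'⟩ h' rfl
    simp at h h'
    exact Prod.ext rfl (h.2.trans h'.2.symm)
  calc ∏ i ∈ Finset.range (m + 1), (fiber (rel i) y).length
      = ∏ i : Fin (m + 1), (fiber (rel i) y).toFinset.card := by
        rw [Finset.prod_range]
        exact Finset.prod_congr rfl fun i _ =>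
          (List.toFinset_card_of_nodup (hnodup i (by omega))).symm
    _ = (Fintype.piFinset fun i : Fin (m + 1) => (fiber (rel i) y).toFinset).card := by simp
    _ = ((Fintype.piFinset fun i : Fin (m + 1) => (fiber (rel i) y).toFinset).image
          List.ofFn).card := (Finset.card_image_of_injective _ List.ofFn_injective).symm
    _ ≤ E.toFinset.card := by
        refine Finset.card_le_card fun e he => ?_
        obtain ⟨g, hg, rfl⟩ := Finset.mem_image.1 he
        simp only [Fintype.mem_piFinset, List.mem_toFinset, mem_fiber] at hg
        rw [List.mem_toFinset, hE]
        refine ⟨y, fun i => if h : i < m + 1 then g ⟨i, h⟩ else 0, fun k hk => ?_, ?_⟩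
        · simpa [Nat.lt_succ_of_le hk] using hg ⟨k, by omega⟩
        · rw [← ofFn_eq_map_range]
          simp
    _ ≤ E.length := List.toFinset_card_le E

end CQEval

namespace CQEval

/-! ### Projection width -/

/-- For ℓ ≥ 2, y is never isolated and the private variable of an atom prevents containment. For ℓ =
1, y may be deleted, so only the set of hyperedges is controlled. -/
theorem alive_of_reduction {ℓ : ℕ} {H : MultiHypergraph (ℓ + 1) ℓ}
    (h : Relation.ReflTransGen (ReductionStep (starQuery ℓ).free) (starQuery ℓ).hypergraph H) :
    H.alive = Finset.univ ∧ (ℓ ≠ 1 → H.edge = (starQuery ℓ).atom) := by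
  induction h with
  | refl => exact ⟨rfl, fun _ => rfl⟩
  | tail _ hstep ih =>
    obtain ⟨h1, h2⟩ := ih
    cases hstep with
    | removeVariable x a hx ha hxa hiso =>
      refine ⟨h1, fun hℓ => absurd ?_ hℓ⟩
      have hx' : x = Fin.last ℓ := by simpa [starQuery] using hx
      have : ∀ b, b = a := fun b => hiso b (by simp [h1]) (by simp [h2 hℓ, hx', starQuery])
      have hcard : Fintype.card (Fin ℓ) = 1 := Fintype.card_eq_one_iff.2 ⟨a, this⟩
      simpa using hcard
    | removeEdge a b ha hb hab hsub =>
      exfalso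
      by_cases hℓ : ℓ = 1
      · subst hℓ
        exact hab (Subsingleton.elim _ _)
      · have := hsub (show a.castSucc ∈ _ by simp [h2 hℓ, starQuery])
        simp [h2 hℓ, starQuery, hab, Fin.castSucc_ne_last] at this

theorem starQuery_isReduction (ℓ : ℕ) (hℓ : 1 ≤ ℓ) : ∃ H, (starQuery ℓ).IsReduction H := by
  have hnoEdge : ∀ {H : MultiHypergraph (ℓ + 1) ℓ} {a b : Fin ℓ},
      (∀ a, a.castSucc ∈ H.edge a ∧ H.edge a ⊆ (starQuery ℓ).atom a) → a ≠ b →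
      ¬ H.edge a ⊆ H.edge b := by
    intro H a b h hab hsub
    have := (h b).2 (hsub (h a).1)
    simp [starQuery, hab, Fin.castSucc_ne_last] at this
  have hlast : ∀ {x : Fin (ℓ + 1)}, x ∉ (starQuery ℓ).free → x = Fin.last ℓ := fun hx => by
    simpa [starQuery] using hx
  by_cases h1 : ℓ = 1
  · subst h1
    refine ⟨_, Relation.ReflTransGen.single (ReductionStep.removeVariable _ (Fin.last 1) 0
      (by simp [starQuery]) (by simp [CQ.hypergraph]) (by simp [CQ.hypergraph, starQuery])
      fun b _ _ => Subsingleton.elim _ _), fun H' hstep => ?_⟩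
    cases hstep with
    | removeVariable x a hx ha hxa hiso =>
      obtain rfl := hlast hx
      obtain rfl : a = 0 := Subsingleton.elim _ _
      simp at hxa
    | removeEdge a b ha hb hab hsub => exact hab (Subsingleton.elim _ _)
  · refine ⟨_, Relation.ReflTransGen.refl, fun H' hstep => ?_⟩
    cases hstep with
    | removeVariable x a hx ha hxa hiso =>
      obtain rfl := hlast hx
      have : ∀ b, b = a := fun b =>
        hiso b (by simp [CQ.hypergraph]) (by simp [CQ.hypergraph, starQuery])
      have hcard : Fintype.card (Fin ℓ) = 1 := Fintype.card_eq_one_iff.2 ⟨a, this⟩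
      exact h1 (by simpa using hcard)
    | removeEdge a b ha hb hab hsub =>
      exact hnoEdge (fun a => ⟨by simp [CQ.hypergraph, starQuery], subset_rfl⟩) hab hsub

theorem starQuery_hasProjectionWidth (ℓ : ℕ) (hℓ : 1 ≤ ℓ) :
    (starQuery ℓ).HasProjectionWidth ℓ := by
  refine ⟨starQuery_isReduction ℓ hℓ, fun H hH => ?_⟩
  obtain ⟨h1, h2⟩ := alive_of_reduction hH.1
  set G := H.existsGraph (starQuery ℓ).free with hG
  have hadj : ∀ a b, a ≠ b → G.Adj a b := by
    intro a b hab
    -- Two distinct hyperedges exclude ℓ = 1, so the hyperedges are the original atoms and share y.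
    have hℓ1 : ℓ ≠ 1 := by
      rintro rfl
      exact hab (Subtype.ext (Subsingleton.elim _ _))
    exact ⟨hab, Fin.last ℓ, by simp [starQuery], by simp [h2 hℓ1, starQuery],
      by simp [h2 hℓ1, starQuery]⟩
  have hsupp : ∀ c : G.ConnectedComponent, c.supp.ncard = ℓ := by
    intro c
    have : c.supp = Set.univ := by
      refine Set.eq_univ_of_forall fun a => ?_
      induction c using SimpleGraph.ConnectedComponent.ind with
      | _ b =>
        rw [SimpleGraph.ConnectedComponent.mem_supp_iff, SimpleGraph.ConnectedComponent.eq]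
        by_cases hab : a = b
        · rw [hab]
        · exact (hadj a b hab).reachable
    rw [this, Set.ncard_univ, Nat.card_eq_fintype_card, Fintype.card_coe, h1, Finset.card_univ,
      Fintype.card_fin]
  have ha : (⟨0, hℓ⟩ : Fin ℓ) ∈ H.alive := by simp [h1]
  refine ⟨⟨G.connectedComponentMk ⟨_, ha⟩, hsupp _⟩, ?_⟩
  rintro _ ⟨c, rfl⟩
  exact (hsupp c).le

/-! ### Encodings of tuples -/

/-- A finite set has only one increasing enumeration, so any explicit one may replace the abstract
order isomorphism. -/
theorem encodeTuple_eq {n k : ℕ} {S : Finset (Fin n)} (hk : S.card = k) {g : Fin k → Fin n}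
    (hg : ∀ j, g j ∈ S) (hmono : StrictMono g) (u : Tuple S) :
    encodeTuple u = List.ofFn fun j => u ⟨g j, hg j⟩ := by
  subst hk
  unfold encodeTuple
  congr 1
  funext j
  congr 1
  exact Subtype.ext ((Finset.coe_orderIsoOfFin_apply S rfl j).trans
    (congrFun (Finset.orderEmbOfFin_unique rfl hg hmono) j).symm)

theorem encodeTuple_injective {n : ℕ} {S : Finset (Fin n)} :
    Function.Injective (encodeTuple (S := S)) := by
  intro u u' h
  have h1 := List.ofFn_injective h
  funext x
  simpa using congrFun h1 ((S.orderIsoOfFin rfl).symm x)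

theorem mem_atom_left {ℓ : ℕ} (a : Fin ℓ) : a.castSucc ∈ (starQuery ℓ).atom a := by
  simp [starQuery]

theorem mem_atom_right {ℓ : ℕ} (a : Fin ℓ) : Fin.last ℓ ∈ (starQuery ℓ).atom a := by
  simp [starQuery]

theorem mem_free {ℓ : ℕ} (a : Fin ℓ) : a.castSucc ∈ (starQuery ℓ).free := by
  simp [starQuery, Fin.castSucc_ne_last]

/-- The tuples of the atoms of the star query are pairs. -/
def toPair {ℓ : ℕ} {a : Fin ℓ} (u : Tuple ((starQuery ℓ).atom a)) : ℕ × ℕ :=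
  (u ⟨_, mem_atom_left a⟩, u ⟨_, mem_atom_right a⟩)

theorem encodeTuple_atom {ℓ : ℕ} {a : Fin ℓ} (u : Tuple ((starQuery ℓ).atom a)) :
    encodeTuple u = [(toPair u).1, (toPair u).2] := by
  refine (encodeTuple_eq (S := (starQuery ℓ).atom a) (k := 2) (g := ![a.castSucc, Fin.last ℓ])
    (Finset.card_pair (Fin.castSucc_ne_last a)) ?_ ?_ u).trans ?_
  · intro j
    fin_cases j
    · exact mem_atom_left a
    · exact mem_atom_right a
  · intro i j hij
    fin_cases i <;> fin_cases j <;> simp_all [Fin.castSucc_lt_last]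
  · simp [toPair]

theorem toPair_injective {ℓ : ℕ} {a : Fin ℓ} : Function.Injective (toPair (a := a)) := by
  intro u u' h
  apply encodeTuple_injective
  rw [encodeTuple_atom, encodeTuple_atom, h]

theorem encodeTuple_free {ℓ : ℕ} (v : Fin (ℓ + 1) → ℕ) (f : ℕ → ℕ)
    (hf : ∀ i : Fin ℓ, v i.castSucc = f i) :
    encodeTuple (restrict (starQuery ℓ).free v) = (List.range ℓ).map f := by
  rw [encodeTuple_eq (k := ℓ) (g := Fin.castSucc) (by simp [starQuery]) mem_free
    (Fin.strictMono_castSucc), ← ofFn_eq_map_range]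
  simp [restrict, hf]

/-- The relations as lists of pairs of numbers. -/
def relation {ℓ : ℕ} (L : (a : Fin ℓ) → List (Tuple ((starQuery ℓ).atom a))) (i : ℕ) :
    List (ℕ × ℕ) :=
  if h : i < ℓ then (L ⟨i, h⟩).map toPair else []

theorem relation_val {ℓ : ℕ} (L : (a : Fin ℓ) → List (Tuple ((starQuery ℓ).atom a))) (a : Fin ℓ) :
    relation L a = (L a).map toPair := by
  simp [relation]

theorem input_eq {ℓ : ℕ} (L : (a : Fin ℓ) → List (Tuple ((starQuery ℓ).atom a))) :
    (List.ofFn fun a => (L a).length :: (L a).flatMap encodeTuple).flatten =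
      (List.range ℓ).flatMap fun i => (relation L i).length :: pairsInput (relation L i) := by
  rw [List.flatMap, ← ofFn_eq_map_range]
  congr 2
  funext a
  rw [relation_val, List.length_map, pairsInput, List.flatMap_map]
  congr 2
  funext u
  exact encodeTuple_atom u

/-! ### Answers, sizes and the final bounds -/

variable {m : ℕ} {D : (starQuery (m + 1)).Database}
  {L : (a : Fin (m + 1)) → List (Tuple ((starQuery (m + 1)).atom a))}

theorem exists_answer_iff (hL : ∀ a, Lists (L a) (D a : Set _)) (e : List ℕ) :
    (∃ u ∈ (starQuery (m + 1)).answers D, encodeTuple u = e) ↔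
      ∃ y f, (∀ k ≤ m, (f k, y) ∈ relation L k) ∧ e = (List.range (m + 1)).map f := by
  have key : ∀ (v : Fin (m + 2) → ℕ) (a : Fin (m + 1)),
      (v a.castSucc, v (Fin.last _)) ∈ relation L a ↔
        restrict ((starQuery (m + 1)).atom a) v ∈ D a := by
    intro v a
    rw [relation_val, show (v a.castSucc, v (Fin.last _)) =
      toPair (restrict ((starQuery (m + 1)).atom a) v) from rfl,
      List.mem_map_of_injective toPair_injective, (hL a).2, Finset.mem_coe]
  constructor
  · rintro ⟨u, ⟨v, hv, rfl⟩, rfl⟩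
    refine ⟨v (Fin.last _), fun i => if h : i < m + 1 then v (Fin.castSucc ⟨i, h⟩) else 0,
      fun k hk => ?_, ?_⟩
    · have := (key v ⟨k, by omega⟩).2 (hv _)
      simpa [Nat.lt_succ_of_le hk] using this
    · exact encodeTuple_free v _ fun i => by rw [dif_pos i.is_lt]
  · rintro ⟨y, f, hf, rfl⟩
    have hv : ∀ i : Fin (m + 1), (Fin.snoc (α := fun _ => ℕ) (fun i : Fin (m + 1) => f i) y :
        Fin (m + 2) → ℕ) i.castSucc = f i := fun i => by
      rw [Fin.snoc_castSucc]
    refine ⟨_, ⟨Fin.snoc (α := fun _ => ℕ) (fun i : Fin (m + 1) => f i) y, fun a => ?_, rfl⟩,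
      encodeTuple_free _ f hv⟩
    rw [← key, hv, Fin.snoc_last]
    exact hf a (by omega)

theorem Lists.ncard_eq {α : Type} {l : List α} {S : Set α} (h : Lists l S) :
    S.ncard = l.length := by
  classical
  have : S = (l.toFinset : Set α) := by
    ext u
    simp [h.2]
  rw [this, Set.ncard_coe_finset, List.toFinset_card_of_nodup h.1]

theorem size_eq (hL : ∀ a, Lists (L a) (D a : Set _)) :
    (starQuery (m + 1)).size D = ∑ i ∈ Finset.range (m + 1), (relation L i).length := by
  rw [Finset.sum_range, CQ.size]
  refine Finset.sum_congr rfl fun a _ => ?_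
  rw [relation_val, List.length_map, ← (hL a).ncard_eq, Set.ncard_coe_finset]

/-- A list of all encoded answers lists the answers. -/
theorem exists_lists_answers {n k : ℕ} {Q : CQ n k} {D : Q.Database} {E : List (List ℕ)}
    (hE : E.Nodup) (h : ∀ e, (∃ u ∈ Q.answers D, encodeTuple u = e) ↔ e ∈ E) :
    ∃ l : List (Tuple Q.free), Lists l (Q.answers D) ∧ l.flatMap encodeTuple = E.flatten ∧
      l.length = E.length := by
  -- A left inverse of the encoding decodes the written lists.
  obtain ⟨g, hg⟩ := encodeTuple_injective (S := Q.free).hasLeftInverse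
  have hgE : ∀ e ∈ E, encodeTuple (g e) = e := fun e he => by
    obtain ⟨u, -, rfl⟩ := (h e).2 he
    rw [hg u]
  refine ⟨E.map g, ⟨List.Nodup.map_on (fun e he e' he' hee => ?_) hE, fun u => ?_⟩, ?_, by simp⟩
  · rw [← hgE e he, hee, hgE e' he']
  · rw [List.mem_map]
    constructor
    · rintro ⟨e, he, rfl⟩
      obtain ⟨u, hu, rfl⟩ := (h e).2 he
      rwa [hg u]
    · exact fun hu => ⟨_, (h _).1 ⟨u, hu, rfl⟩, hg u⟩
  · rw [List.flatMap_map, List.flatMap, List.map_congr_left hgE, List.map_id']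

/-- There is a least bound for the size and the constants of a database. -/
theorem exists_least_bound {n k : ℕ} {Q : CQ n k} (D : Q.Database) :
    ∃ N, (Q.size D ≤ N ∧ ∀ a, ∀ u ∈ D a, ∀ x, u x ≤ N) ∧
      ∀ N', (Q.size D ≤ N' ∧ ∀ a, ∀ u ∈ D a, ∀ x, u x ≤ N') → N ≤ N' := by
  classical
  have hex : ∃ N, Q.size D ≤ N ∧ ∀ a, ∀ u ∈ D a, ∀ x, u x ≤ N := by
    refine ⟨Q.size D + ∑ a, ∑ u ∈ D a, ∑ x, u x, Nat.le_add_right _ _, fun a u hu x => ?_⟩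
    calc u x ≤ ∑ x, u x := Finset.single_le_sum (fun _ _ => Nat.zero_le _) (Finset.mem_univ x)
      _ ≤ ∑ u ∈ D a, ∑ x, u x :=
        Finset.single_le_sum (f := fun u => ∑ x, u x) (fun _ _ => Nat.zero_le _) hu
      _ ≤ ∑ a, ∑ u ∈ D a, ∑ x, u x :=
        Finset.single_le_sum (f := fun a => ∑ u ∈ D a, ∑ x, u x) (fun _ _ => Nat.zero_le _)
          (Finset.mem_univ a)
      _ ≤ _ := Nat.le_add_left _ _
  exact ⟨Nat.find hex, Nat.find_spec hex, fun N' h => Nat.find_min' hex h⟩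

theorem starQuery_evaluableInTime (m : ℕ) : (starQuery (m + 1)).EvaluableInTime fun d out =>
    (d : ℝ) + (d : ℝ) * (out : ℝ) ^ (1 - 1 / ((m + 1 : ℕ) : ℝ)) := by
  obtain ⟨κ, hκ⟩ := exists_wordBound m
  refine ⟨(Cmd.starJoin m).compile 0, 33 * m + 60, κ, fun D w ⟨L, hL, hw⟩ => ?_⟩
  -- The run is analysed for the least admissible N; larger ones follow by monotonicity of the
  -- power.
  obtain ⟨N, ⟨hN, hND⟩, hmin⟩ := exists_least_bound D
  rw [input_eq] at hw
  have hsize := size_eq hL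
  have hlen : ∀ i ≤ m, (relation L i).length ≤ (starQuery (m + 1)).size D := fun i hi => by
    rw [hsize]
    exact Finset.single_le_sum (f := fun i => (relation L i).length) (fun _ _ => Nat.zero_le _)
      (by simp; omega)
  have hrel : ∀ i ≤ m, ∀ t ∈ relation L i, t.1 ≤ N ∧ t.2 ≤ N := by
    intro i hi t ht
    rw [relation, dif_pos (Nat.lt_succ_of_le hi), List.mem_map] at ht
    obtain ⟨u, hu, rfl⟩ := ht
    have := hND _ u (((hL _).2 u).1 hu)
    exact ⟨this _, this _⟩
  have hnodup : ∀ i ≤ m, (relation L i).Nodup := by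
    intro i hi
    rw [relation, dif_pos (Nat.lt_succ_of_le hi)]
    exact (hL _).1.map toPair_injective
  have hwp := WP.starJoin (w := w) (hκ N) (relation L)
    (fun i hi => ((hlen i hi).trans hN).trans (by omega))
    fun i hi t ht => ⟨(hrel i hi t ht).1.trans (by omega), (hrel i hi t ht).2.trans (by omega)⟩
  rw [← hw] at hwp
  obtain ⟨s, ⟨ht, E, hE, hout, hmem⟩, hhalt, hout', hbound⟩ := hwp.run_compile (by positivity)
  obtain ⟨l, hl, hlE, hlen'⟩ := exists_lists_answers (D := D) hE fun e =>
    (exists_answer_iff hL e).trans (hmem e).symm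
  refine ⟨s.time, hhalt, ⟨l, hl, ?_⟩, ?_, fun N' hN' hND' u hu p => ?_⟩
  · rw [hout', hout, hlE, hlen']
  · have hjoin := sum_join_le (prod_length_fiber_le hnodup hmem)
    rw [← hsize, ← hlen', ← hl.ncard_eq] at hjoin
    set S := ((relation L m).map fun t =>
      ∏ i ∈ Finset.range m, (fiber (relation L i) t.2).length).sum with hS
    have hsum : ((relation L m).map fun t => 9 * m + 8 + (21 * m + 19) *
        ∏ i ∈ Finset.range m, (fiber (relation L i) t.2).length).sum =
        (9 * m + 8) * (relation L m).length + (21 * m + 19) * S := by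
      rw [List.sum_map_add, List.sum_map_mul_left]
      simp [hS, Nat.mul_comm]
    rw [hsum, Finset.sum_add_distrib, ← Finset.mul_sum] at ht
    rw [Finset.sum_range_succ] at hsize
    set d := (starQuery (m + 1)).size D with hd
    set J := (d : ℝ) * ((((starQuery (m + 1)).answers D).ncard : ℕ) : ℝ) ^
      (1 - 1 / ((m + 1 : ℕ) : ℝ)) with hJ
    have ht' : s.time ≤ 5 + 3 * m + (9 * m + 27) * d + (21 * m + 19) * S := by
      simp only [Finset.sum_const, Finset.card_range, smul_eq_mul] at ht
      rw [hsize]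
      have h1 := Nat.mul_le_mul_right (∑ i ∈ Finset.range m, (relation L i).length)
        (show 19 ≤ 9 * m + 27 by omega)
      have h2 := Nat.mul_le_mul_right (relation L m).length (show 9 * m + 8 ≤ 9 * m + 27 by omega)
      rw [Nat.mul_add]
      linarith
    have ht2 : (s.time : ℝ) ≤ 5 + 3 * m + (9 * m + 27) * d + (21 * m + 19) * S := by
      exact_mod_cast ht'
    have hJ0 : 0 ≤ J := by positivity
    have hd0 : (0 : ℝ) ≤ d := Nat.cast_nonneg _
    have hm0 : (0 : ℝ) ≤ m := Nat.cast_nonneg _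
    have h1 := le_max_left (1 : ℝ) (d + J)
    have h2 := le_max_right (1 : ℝ) (d + J)
    set M := max (1 : ℝ) (d + J)
    -- Constant, linear and join terms are each bounded by M; the coefficients add up to 33m + 51,
    -- within the chosen constant.
    calc (s.time : ℝ) ≤ (5 + 3 * m) * 1 + (9 * m + 27) * d + (21 * m + 19) * S := by linarith
      _ ≤ (5 + 3 * m) * M + (9 * m + 27) * M + (21 * m + 19) * M := by
        gcongr <;> linarith
      _ ≤ _ := by nlinarith
  · have hle : (N + 2) ^ κ ≤ (N' + 2) ^ κ :=
      Nat.pow_le_pow_left (Nat.add_le_add_right (hmin N' ⟨hN', hND'⟩) 2) κ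
    exact ⟨(hbound u hu p).1.trans_le hle, (hbound u hu p).2.trans_le hle⟩

end CQEval

theorem mainTheorem12 (ℓ : ℕ) (hℓ : 1 ≤ ℓ) :
    (CQEval.starQuery ℓ).HasProjectionWidth ℓ ∧
      (CQEval.starQuery ℓ).EvaluableInTime
        (fun d out => (d : ℝ) + (d : ℝ) * (out : ℝ) ^ (1 - 1 / (ℓ : ℝ))) := by
  refine ⟨CQEval.starQuery_hasProjectionWidth ℓ hℓ, ?_⟩
  obtain ⟨m, rfl⟩ := Nat.exists_eq_add_of_le' hℓ
  exact CQEval.starQuery_evaluableInTime m
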